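/- Let $G$ be a (finite-dimensional, real, smooth) Lie group with multiplication $m:G\times G\to G$, and let $\nabla$ be a smooth affine connection on $G$ (a covariant derivative on $TG$). Let $\nabla\oplus\nabla$ be the product connection on $G\times G$, i.e. the connection with $(\nabla\oplus\nabla)_{(X_1,Y_1)}(X_2,Y_2)=(\nabla_{X_1}X_2,\nabla_{Y_1}Y_2)$ for vector fields $(a,b)\mapsto (X_i(a),Y_i(b))$. A smooth map $f:(M,\nabla)\to(N,\nabla')$ is called affine (it preserves the connections) if, whenever a vector field $Y$ on $M$ is $f$-related near $x\in M$ to a vector field $Y'$ on $N$, one has $df(\nabla_vY)=\nabla'_{df(v)}Y'$ for all $v\in T_xM$. 1. If $G$ is connected and $m:(G\times G,\nabla\oplus\nabla)\to(G,\nabla)$ is affine, then $G$ is abelian and $\nabla$ is bi-invariant, i.e. all left and all right translations of $G$ are affine maps $(G,\nabla)\to(G,\nabla)$. 2. A contravariant pseudo-Hessian structure on a manifold is a pair $(\nabla,h)$ of a flat torsion-free connection $\nabla$ and a symmetric bivector field $h$ such that $(\nabla_{h_\#(\alpha)}h)(\beta,\gamma)=(\nabla_{h_\#(\beta)}h)(\alpha,\gamma)$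 for all 1-forms $\alpha,\beta,\gamma$, where $\beta(h_\#(\alpha))=h(\alpha,\beta)$. Such a structure on the Lie group $G$ is multiplicative if $m:(G\times G,\nabla\oplus\nabla)\to(G,\nabla)$ is affine and sends $h\oplus h$ to $h$, i.e. $(h\oplus h)(m^*\alpha,m^*\beta)=h(\alpha,\beta)\circ m$. If $G$ is simply connected and $(\nabla,h)$ is a multiplicative contravariant pseudo-Hessian structure on $G$, then there are a finite-dimensional real vector space $V$ and an isomorphism of Lie groups $\Phi:G\to(V,+)$ which carries $\nabla$ to the canonical affine connection of $V$ and $h$ to a linear bivector field $h'$ on $V$; linear means that there is a commutative bilinear product $\bullet$ on $V^*$ such that $h'(\alpha,\beta)(u)=\langle\alpha\bullet\beta,u\rangle$ for all $\alpha,\beta\in V^*$ (seen as constant 1-forms) and all $u\in V$. -/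

import Mathlib

open scoped Manifold ContDiff Bundle Topology

noncomputable section

/-- An affine connection on `M`: a covariant derivative on the tangent bundle.
`cov Y x v` is `(∇_v Y)(x)`. -/
abbrev AffineConnection {E : Type*} [NormedAddCommGroup E] [NormedSpace ℝ E]
    {H : Type*} [TopologicalSpace H] (I : ModelWithCorners ℝ E H)
    (M : Type*) [TopologicalSpace M] [ChartedSpace H M] [IsManifold I 1 M] :=
  CovariantDerivative I E (TangentSpace I : M → Type _)

lemma add_combine {V : Type*} [AddCommGroup V] {A B A₁ A₂ B₁ B₂ : V}
    (a : A = A₁ + A₂) (b : B = B₁ + B₂) : A + B = (A₁ + B₁) + (A₂ + B₂) := by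
  rw [a, b]; abel

lemma leibniz_combine {V : Type*} [AddCommGroup V] [Module ℝ V] {A A' B B' S : V} {c p q r : ℝ}
    (e : r = p + q) (a : A' = c • A + p • S) (b : B' = c • B + q • S) :
    A' + B' = c • (A + B) + r • S := by
  rw [a, b, e]; module

section Connections

variable {E : Type*} [NormedAddCommGroup E] [NormedSpace ℝ E]
  {H : Type*} [TopologicalSpace H] {I : ModelWithCorners ℝ E H}
  {M : Type*} [TopologicalSpace M] [ChartedSpace H M]
  {E' : Type*} [NormedAddCommGroup E'] [NormedSpace ℝ E']
  {H' : Type*} [TopologicalSpace H'] {J : ModelWithCorners ℝ E' H'}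
  {N : Type*} [TopologicalSpace N] [ChartedSpace H' N]

lemma mdifferentiableAt_fiber_map [IsManifold I 1 M] {x : M} {y : N} {s : N → E}
    (hs : MDifferentiableAt J I.tangent
      (fun y' => (⟨x, (s y' : TangentSpace I x)⟩ : TangentBundle I M)) y) :
    MDifferentiableAt J 𝓘(ℝ, E) s y := by
  rw [mdifferentiableAt_totalSpace] at hs
  have h2 := hs.2
  have key : ∀ w : E, (trivializationAt E (TangentSpace I) x
      (⟨x, (w : TangentSpace I x)⟩ : TangentBundle I M)).2 = w := fun w =>
    congrArg Prod.snd (VectorBundleCore.localTrivAt_apply_mk (tangentBundleCore I M) x w)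
  simpa only [key] using h2

lemma mdifferentiableAt_left (x : M) (y : N) :
    MDifferentiableAt I (I.prod J) (fun x' : M => (x', y)) x :=
  mdifferentiableAt_id.prodMk mdifferentiableAt_const

lemma mdifferentiableAt_right (x : M) (y : N) :
    MDifferentiableAt J (I.prod J) (fun y' : N => (x, y')) y :=
  mdifferentiableAt_const.prodMk mdifferentiableAt_id

section Slices

variable [IsManifold I 1 M] [IsManifold J 1 N]
  {σ : Π p : M × N, TangentSpace (I.prod J) p} {x : M} {y : N}

lemma mdifferentiableAt_fst_component
    (hσ : MDifferentiableAt (I.prod J) (I.prod J).tangent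
      (fun p => (⟨p, σ p⟩ : TangentBundle (I.prod J) (M × N))) (x, y)) :
    MDifferentiableAt (I.prod J) I.tangent
      (fun q : M × N => (⟨q.1, (σ q).1⟩ : TangentBundle I M)) (x, y) := by
  have h := (contMDiff_equivTangentBundleProd (I := I) (I' := J) (M := M) (M' := N) (n := 1)
    (⟨(x, y), σ (x, y)⟩ : TangentBundle (I.prod J) (M × N))).mdifferentiableAt (by simp)
  exact mdifferentiableAt_fst.comp (x, y) (h.comp (x, y) hσ)

lemma mdifferentiableAt_snd_component
    (hσ : MDifferentiableAt (I.prod J) (I.prod J).tangent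
      (fun p => (⟨p, σ p⟩ : TangentBundle (I.prod J) (M × N))) (x, y)) :
    MDifferentiableAt (I.prod J) J.tangent
      (fun q : M × N => (⟨q.2, (σ q).2⟩ : TangentBundle J N)) (x, y) := by
  have h := (contMDiff_equivTangentBundleProd (I := I) (I' := J) (M := M) (M' := N) (n := 1)
    (⟨(x, y), σ (x, y)⟩ : TangentBundle (I.prod J) (M × N))).mdifferentiableAt (by simp)
  exact mdifferentiableAt_snd.comp (x, y) (h.comp (x, y) hσ)

lemma mdifferentiableAt_slice11
    (hσ : MDifferentiableAt (I.prod J) (I.prod J).tangent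
      (fun p => (⟨p, σ p⟩ : TangentBundle (I.prod J) (M × N))) (x, y)) :
    MDifferentiableAt I I.tangent
      (fun x' : M => (⟨x', (σ (x', y)).1⟩ : TangentBundle I M)) x :=
  (mdifferentiableAt_fst_component hσ).comp x (mdifferentiableAt_left x y)

lemma mdifferentiableAt_slice22
    (hσ : MDifferentiableAt (I.prod J) (I.prod J).tangent
      (fun p => (⟨p, σ p⟩ : TangentBundle (I.prod J) (M × N))) (x, y)) :
    MDifferentiableAt J J.tangent
      (fun y' : N => (⟨y', (σ (x, y')).2⟩ : TangentBundle J N)) y :=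
  (mdifferentiableAt_snd_component hσ).comp y (mdifferentiableAt_right x y)

lemma mdifferentiableAt_slice12
    (hσ : MDifferentiableAt (I.prod J) (I.prod J).tangent
      (fun p => (⟨p, σ p⟩ : TangentBundle (I.prod J) (M × N))) (x, y)) :
    MDifferentiableAt J 𝓘(ℝ, E) (fun y' : N => ((σ (x, y')).1 : E)) y :=
  mdifferentiableAt_fiber_map (x := x) (I := I) (s := fun y' : N => ((σ (x, y')).1 : E))
    ((mdifferentiableAt_fst_component hσ).comp y (mdifferentiableAt_right x y))

lemma mdifferentiableAt_slice21
    (hσ : MDifferentiableAt (I.prod J) (I.prod J).tangent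
      (fun p => (⟨p, σ p⟩ : TangentBundle (I.prod J) (M × N))) (x, y)) :
    MDifferentiableAt I 𝓘(ℝ, E') (fun x' : M => ((σ (x', y)).2 : E')) x := by
  have h : MDifferentiableAt I J.tangent
      (fun x' : M => (⟨y, (σ (x', y)).2⟩ : TangentBundle J N)) x :=
    MDifferentiableAt.comp (I' := I.prod J)
      (g := fun q : M × N => (⟨q.2, (σ q).2⟩ : TangentBundle J N))
      (f := fun x' : M => (x', y)) x
      (mdifferentiableAt_snd_component hσ) (mdifferentiableAt_left x y)
  exact mdifferentiableAt_fiber_map (x := y) (I := J)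
    (s := fun x' : M => ((σ (x', y)).2 : E')) h

end Slices

variable [IsManifold I 1 M] [IsManifold J 1 N]

/-- The underlying map of the product connection: for a vector field `σ = (σ₁, σ₂)` on `M × N`
and `(u, v) ∈ T_xM × T_yN`,
`∇_{(u,v)} σ = (∇_u σ₁(·, y) + d(σ₁(x, ·))(v), d(σ₂(·, y))(u) + ∇'_v σ₂(x, ·))`;
here `σ₁(x, ·)` takes values in the fixed vector space `T_xM`, and `σ₂(·, y)` in `T_yN`. -/
def prodConnectionFun (cov : AffineConnection I M) (cov' : AffineConnection J N)
    (σ : Π p : M × N, TangentSpace (I.prod J) p) (p : M × N) :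
    TangentSpace (I.prod J) p →L[ℝ] TangentSpace (I.prod J) p :=
  let A₁₁ : E →L[ℝ] E := cov (fun x => (σ (x, p.2)).1) p.1
  let A₁₂ : E' →L[ℝ] E := mvfderiv J (fun y => ((σ (p.1, y)).1 : E)) p.2
  let A₂₁ : E →L[ℝ] E' := mvfderiv I (fun x => ((σ (x, p.2)).2 : E')) p.1
  let A₂₂ : E' →L[ℝ] E' := cov' (fun y => (σ (p.1, y)).2) p.2
  (A₁₁.coprod A₁₂).prod (A₂₁.coprod A₂₂)

/-- The product connection `∇ ⊕ ∇'` on `M × N`; on vector fields of the form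
`(x, y) ↦ (X x, Y y)` it is `(∇_{X₁} X₂, ∇'_{Y₁} Y₂)`. -/
def prodConnection (cov : AffineConnection I M) (cov' : AffineConnection J N) :
    AffineConnection (I.prod J) (M × N) where
  toFun := prodConnectionFun cov cov'
  isCovariantDerivativeOnUniv :=
    { add := by
        rintro σ σ' ⟨x, y⟩ hσ hσ' -
        have a := cov.isCovariantDerivativeOnUniv.add
          (mdifferentiableAt_slice11 hσ) (mdifferentiableAt_slice11 hσ')
        have b := cov'.isCovariantDerivativeOnUniv.add
          (mdifferentiableAt_slice22 hσ) (mdifferentiableAt_slice22 hσ')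
        have c := mvfderiv_add (mdifferentiableAt_slice12 hσ) (mdifferentiableAt_slice12 hσ')
        have d := mvfderiv_add (mdifferentiableAt_slice21 hσ) (mdifferentiableAt_slice21 hσ')
        refine ContinuousLinearMap.ext fun w => ?_
        refine Prod.ext ?_ ?_
        · exact add_combine (V := E) (DFunLike.congr_fun a w.1) (DFunLike.congr_fun c w.2)
        · exact add_combine (V := E') (DFunLike.congr_fun d w.1) (DFunLike.congr_fun b w.2)
      leibniz := by
        rintro σ g ⟨x, y⟩ hσ hg -
        have hg₁ : MDifferentiableAt I 𝓘(ℝ, ℝ) (fun x' => g (x', y)) x :=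
          hg.comp x (mdifferentiableAt_left x y)
        have hg₂ : MDifferentiableAt J 𝓘(ℝ, ℝ) (fun y' => g (x, y')) y :=
          hg.comp y (mdifferentiableAt_right x y)
        have a := cov.isCovariantDerivativeOnUniv.leibniz (mdifferentiableAt_slice11 hσ) hg₁
        have b := cov'.isCovariantDerivativeOnUniv.leibniz (mdifferentiableAt_slice22 hσ) hg₂
        have c := mvfderiv_smul hg₂ (mdifferentiableAt_slice12 hσ)
        have d := mvfderiv_smul hg₁ (mdifferentiableAt_slice21 hσ)
        have e : ∀ w : E × E', (mvfderiv (I.prod J) g (x, y) : E × E' →L[ℝ] ℝ) w =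
            (mvfderiv I (fun x' => g (x', y)) x : E →L[ℝ] ℝ) w.1 +
              (mvfderiv J (fun y' => g (x, y')) y : E' →L[ℝ] ℝ) w.2 := by
          intro w
          exact mfderiv_prod_eq_add_apply hg
        refine ContinuousLinearMap.ext fun w => ?_
        refine Prod.ext ?_ ?_
        · exact leibniz_combine (V := E) (e w)
            (DFunLike.congr_fun a w.1) (DFunLike.congr_fun c w.2)
        · exact leibniz_combine (V := E') (e w)
            (DFunLike.congr_fun d w.1) (DFunLike.congr_fun b w.2) }

lemma differentiableAt_of_field {V : Type*} [NormedAddCommGroup V] [NormedSpace ℝ V]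
    {Y : Π x : V, TangentSpace 𝓘(ℝ, V) x} {x : V}
    (hY : MDifferentiableAt 𝓘(ℝ, V) 𝓘(ℝ, V).tangent
      (fun z => (⟨z, Y z⟩ : TangentBundle 𝓘(ℝ, V) V)) x) :
    DifferentiableAt ℝ (fun z => (Y z : V)) x := by
  have h := ((contMDiff_snd_tangentBundle_modelSpace V 𝓘(ℝ, V) (n := 1)).mdifferentiable
    (by simp)) (⟨x, Y x⟩ : TangentBundle 𝓘(ℝ, V) V)
  exact (MDifferentiableAt.comp (I' := 𝓘(ℝ, V).tangent)
    (g := fun p : TangentBundle 𝓘(ℝ, V) V => (p.2 : V)) x h hY).differentiableAt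

/-- The canonical (flat) affine connection of a normed space: `∇_v Y = DY(v)`. -/
def canonicalConnection (V : Type*) [NormedAddCommGroup V] [NormedSpace ℝ V] :
    AffineConnection 𝓘(ℝ, V) V where
  toFun Y x := (fderiv ℝ (fun z => (Y z : V)) x : V →L[ℝ] V)
  isCovariantDerivativeOnUniv :=
    { add := by
        intro σ σ' x hσ hσ' _
        have h := differentiableAt_of_field hσ
        have h' := differentiableAt_of_field hσ'
        exact fderiv_add h h'
      leibniz := by
        intro σ g x hσ hg _
        have h := differentiableAt_of_field hσ
        have h' := mfderiv_eq_fderiv (𝕜 := ℝ) (E := V) (E' := ℝ) (f := g) (x := x)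
        refine (fderiv_smul hg.differentiableAt h).trans ?_
        rw [← h']
        rfl }

/-- A vector field `Y` on `M` is smooth at `x`. -/
def SmoothFieldAt (I : ModelWithCorners ℝ E H) {M : Type*} [TopologicalSpace M] [ChartedSpace H M]
    [IsManifold I 1 M] (Y : Π x : M, TangentSpace I x) (x : M) : Prop :=
  ContMDiffAt I I.tangent ∞ (fun y => (⟨y, Y y⟩ : TangentBundle I M)) x

/-- The smooth map `f : (M, ∇) → (N, ∇')` is affine (it preserves the connections): whenever
a vector field `Y` on `M` is `f`-related to a vector field `Y'` on `N` near `x`, then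
`∇_v Y` is mapped to `∇'_{df(v)} Y'` by `df`, for all `v ∈ T_xM`. -/
structure IsAffineMap (cov : AffineConnection I M) (cov' : AffineConnection J N) (f : M → N) :
    Prop where
  smooth : ContMDiff I J ∞ f
  map_cov : ∀ (x : M) (Y : Π x : M, TangentSpace I x) (Y' : Π y : N, TangentSpace J y),
    SmoothFieldAt I Y x → SmoothFieldAt J Y' (f x) →
    (∀ᶠ z in 𝓝 x, mfderiv I J f z (Y z) = Y' (f z)) →
    ∀ v : TangentSpace I x, mfderiv I J f x (cov Y x v) = cov' Y' (f x) (mfderiv I J f x v)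

end Connections

section Bivectors

variable {E : Type*} [NormedAddCommGroup E] [NormedSpace ℝ E]
  {H : Type*} [TopologicalSpace H] {I : ModelWithCorners ℝ E H}
  {M : Type*} [TopologicalSpace M] [ChartedSpace H M]
  {E' : Type*} [NormedAddCommGroup E'] [NormedSpace ℝ E']
  {H' : Type*} [TopologicalSpace H'] {J : ModelWithCorners ℝ E' H'}
  {N : Type*} [TopologicalSpace N] [ChartedSpace H' N]

/-- A (not necessarily smooth) 1-form on `M`. -/
abbrev OneForm (I : ModelWithCorners ℝ E H) (M : Type*) [TopologicalSpace M] [ChartedSpace H M] :=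
  Π x : M, TangentSpace I x →L[ℝ] ℝ

/-- A (not necessarily smooth or symmetric) field `h` of bilinear forms on the cotangent spaces of
`M`, encoded by its contraction `h_# : T*M → TM`; the form itself is `h(α, β) = β(h_#(α))`. -/
abbrev BivectorField (I : ModelWithCorners ℝ E H) (M : Type*) [TopologicalSpace M]
    [ChartedSpace H M] :=
  Π x : M, (TangentSpace I x →L[ℝ] ℝ) →L[ℝ] TangentSpace I x

/-- The bilinear form `h(α, β) = β(h_#(α))` on `T*_xM`. -/
def BivectorField.form (h : BivectorField I M) (x : M) (α β : TangentSpace I x →L[ℝ] ℝ) : ℝ :=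
  β (h x α)

/-- `h` and `h'` are `f`-related: `f` sends `h` to `h'`, i.e.
`h'(α, β) ∘ f = h(f^*α, f^*β)`. -/
def BivectorField.MapsTo (f : M → N) (h : BivectorField I M) (h' : BivectorField J N) : Prop :=
  ∀ (x : M) (α β : TangentSpace J (f x) →L[ℝ] ℝ),
    h.form x (α.comp (mfderiv I J f x)) (β.comp (mfderiv I J f x)) = h'.form (f x) α β

/-- The product `h ⊕ h'` on `M × N`. -/
def BivectorField.prod (h : BivectorField I M) (h' : BivectorField J N) :
    BivectorField (I.prod J) (M × N) := fun p =>
  let A : (E →L[ℝ] ℝ) →L[ℝ] E := h p.1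
  let B : (E' →L[ℝ] ℝ) →L[ℝ] E' := h' p.2
  ((A.comp (ContinuousLinearMap.precomp ℝ (ContinuousLinearMap.inl ℝ E E'))).prod
    (B.comp (ContinuousLinearMap.precomp ℝ (ContinuousLinearMap.inr ℝ E E'))) :
      (E × E' →L[ℝ] ℝ) →L[ℝ] E × E')

variable [IsManifold I 1 M]

/-- A 1-form is differentiable at `x`. -/
def OneForm.DiffAt (α : OneForm I M) (x : M) : Prop :=
  MDifferentiableAt I (I.prod 𝓘(ℝ, E →L[ℝ] ℝ))
    (fun y => Bundle.TotalSpace.mk' (E →L[ℝ] ℝ)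
      (E := fun y : M => TangentSpace I y →L[ℝ] ℝ) y (α y)) x

/-- A 1-form is smooth. -/
def OneForm.Smooth (α : OneForm I M) : Prop :=
  ContMDiff I (I.prod 𝓘(ℝ, E →L[ℝ] ℝ)) ∞
    (fun y => Bundle.TotalSpace.mk' (E →L[ℝ] ℝ)
      (E := fun y : M => TangentSpace I y →L[ℝ] ℝ) y (α y))

/-- A field of bilinear forms on the cotangent spaces is smooth. -/
def BivectorField.Smooth (h : BivectorField I M) : Prop :=
  ContMDiff I (I.prod 𝓘(ℝ, (E →L[ℝ] ℝ) →L[ℝ] E)) ∞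
    (fun y => Bundle.TotalSpace.mk' ((E →L[ℝ] ℝ) →L[ℝ] E)
      (E := fun y : M => (TangentSpace I y →L[ℝ] ℝ) →L[ℝ] TangentSpace I y) y (h y))

/-- A symmetric bivector field. -/
def BivectorField.Symmetric (h : BivectorField I M) : Prop :=
  ∀ (x : M) (α β : TangentSpace I x →L[ℝ] ℝ), h.form x α β = h.form x β α

lemma OneForm.DiffAt.apply {α : OneForm I M} {x : M} (hα : α.DiffAt x)
    {Y : Π x : M, TangentSpace I x}
    (hY : MDifferentiableAt I I.tangent (fun y => (⟨y, Y y⟩ : TangentBundle I M)) x) :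
    MDifferentiableAt I 𝓘(ℝ, ℝ) (fun y => α y (Y y)) x := by
  have h := MDifferentiableAt.clm_bundle_apply (E₂ := fun _ : M => ℝ) (F₂ := ℝ) hα hY
  rw [mdifferentiableAt_totalSpace] at h
  exact h.2

lemma tensorialAt_dual (cov : AffineConnection I M) {α : OneForm I M} {x : M}
    (hα : α.DiffAt x) (v : TangentSpace I x) :
    TensorialAt I E (fun Y : Π x : M, TangentSpace I x =>
      mvfderiv I (fun y => α y (Y y)) x v - α x (cov Y x v)) x where
  smul {f Y} hf hY := by
    have h1 := mvfderiv_mul hf (hα.apply hY)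
    have h2 := cov.isCovariantDerivativeOnUniv.leibniz hY hf
    have h3 : (fun y => α y ((f • Y) y)) = f * (fun y => α y (Y y)) := by
      ext y; simp
    rw [h3, h1, h2]
    simp
    ring
  add {Y Y'} hY hY' := by
    have h1 := mvfderiv_add (hα.apply hY) (hα.apply hY')
    have h2 := cov.isCovariantDerivativeOnUniv.add hY hY'
    have h3 : (fun y => α y ((Y + Y') y)) = (fun y => α y (Y y)) + (fun y => α y (Y' y)) := by
      ext y; simp
    rw [h3, h1, h2]
    simp
    ring

end Bivectors

section PseudoHessian

variable {E : Type*} [NormedAddCommGroup E] [NormedSpace ℝ E] [FiniteDimensional ℝ E]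
  {H : Type*} [TopologicalSpace H] {I : ModelWithCorners ℝ E H}
  {M : Type*} [TopologicalSpace M] [ChartedSpace H M] [IsManifold I ∞ M]

open Classical in
/-- The covariant derivative `(∇_v α)(x)` of a 1-form differentiable at `x`, characterized by
`(∇_v α)(Y x) = v · α(Y) - α(∇_v Y)` for every vector field `Y` differentiable at `x`. -/
def dualCov (cov : AffineConnection I M) (α : OneForm I M) (x : M) (v : TangentSpace I x) :
    TangentSpace I x →L[ℝ] ℝ :=
  if hα : α.DiffAt x then TensorialAt.mkHom _ x (tensorialAt_dual cov hα v) else 0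

lemma dualCov_apply (cov : AffineConnection I M) {α : OneForm I M} {x : M} (hα : α.DiffAt x)
    (v : TangentSpace I x) {Y : Π x : M, TangentSpace I x}
    (hY : MDifferentiableAt I I.tangent (fun y => (⟨y, Y y⟩ : TangentBundle I M)) x) :
    dualCov cov α x v (Y x) = mvfderiv I (fun y => α y (Y y)) x v - α x (cov Y x v) := by
  rw [dualCov, dif_pos hα]
  exact TensorialAt.mkHom_apply (tensorialAt_dual cov hα v) hY

/-- `(∇_v h)(α, β)(x) = v · h(α, β) - h(∇_v α, β) - h(α, ∇_v β)` for 1-forms `α`, `β`. -/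
def covBivector (cov : AffineConnection I M) (h : BivectorField I M) (α β : OneForm I M) (x : M)
    (v : TangentSpace I x) : ℝ :=
  mvfderiv I (fun y => h.form y (α y) (β y)) x v - h.form x (dualCov cov α x v) (β x) -
    h.form x (α x) (dualCov cov β x v)

/-- The curvature of `∇` vanishes: `∇_X ∇_Y Z - ∇_Y ∇_X Z = ∇_{[X, Y]} Z` for all smooth
vector fields. -/
def HasZeroCurvature (cov : AffineConnection I M) : Prop :=
  ∀ X Y Z : Π x : M, TangentSpace I x,
    (∀ x, SmoothFieldAt I X x) → (∀ x, SmoothFieldAt I Y x) → (∀ x, SmoothFieldAt I Z x) →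
    ∀ x, cov (fun y => cov Z y (Y y)) x (X x) - cov (fun y => cov Z y (X y)) x (Y x) =
      cov Z x (VectorField.mlieBracket I X Y x)

/-- `(∇, h)` is a contravariant pseudo-Hessian structure on `M`: `∇` is a smooth flat torsion-free
connection and `h` is a smooth symmetric bivector field satisfying the contravariant Codazzi
equation `(∇_{h_#(α)} h)(β, γ) = (∇_{h_#(β)} h)(α, γ)`. -/
structure IsContravariantPseudoHessian (cov : AffineConnection I M) (h : BivectorField I M) :
    Prop where
  smooth_cov : CovariantDerivative.ContMDiffCovariantDerivative cov ∞
  torsion_eq_zero : cov.torsion = 0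
  curvature_eq_zero : HasZeroCurvature cov
  smooth : h.Smooth
  symmetric : h.Symmetric
  codazzi : ∀ α β γ : OneForm I M, α.Smooth → β.Smooth → γ.Smooth → ∀ x : M,
    covBivector cov h β γ x (h x (α x)) = covBivector cov h α γ x (h x (β x))

end PseudoHessian

section LieGroups

variable {E : Type*} [NormedAddCommGroup E] [NormedSpace ℝ E]
  {H : Type*} [TopologicalSpace H] {I : ModelWithCorners ℝ E H}
  {G : Type*} [TopologicalSpace G] [ChartedSpace H G] [Group G] [LieGroup I ∞ G]

/-- The multiplication `(G × G, ∇ ⊕ ∇) → (G, ∇)` preserves the connections. -/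
def MulPreservesConnection (cov : AffineConnection I G) : Prop :=
  IsAffineMap (prodConnection cov cov) cov (fun p : G × G => p.1 * p.2)

/-- `∇` is bi-invariant: all left and all right translations are affine. -/
def IsBiInvariant (cov : AffineConnection I G) : Prop :=
  ∀ a : G, IsAffineMap cov cov (fun g => a * g) ∧ IsAffineMap cov cov (fun g => g * a)

/-- `(∇, h)` is a multiplicative contravariant pseudo-Hessian structure on the Lie group `G`:
the multiplication `(G × G, ∇ ⊕ ∇, h ⊕ h) → (G, ∇, h)` is affine and sends `h ⊕ h` to `h`. -/
structure IsMultiplicativePseudoHessian [FiniteDimensional ℝ E] (cov : AffineConnection I G)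
    (h : BivectorField I G) : Prop where
  pseudoHessian : IsContravariantPseudoHessian cov h
  mul_affine : MulPreservesConnection cov
  mul_mapsTo : BivectorField.MapsTo (fun p : G × G => p.1 * p.2) (h.prod h) h

end LieGroups

/-- A bivector field `h` on a vector space `V` is linear if there is a commutative product `•` on
`V*` such that `h(α, β)(u) = (α • β)(u)` for all constant 1-forms `α, β ∈ V*` and `u ∈ V`. -/
def IsLinearBivector {V : Type*} [NormedAddCommGroup V] [NormedSpace ℝ V]
    (h : BivectorField 𝓘(ℝ, V) V) : Prop :=
  ∃ mul : (V →L[ℝ] ℝ) →ₗ[ℝ] (V →L[ℝ] ℝ) →ₗ[ℝ] (V →L[ℝ] ℝ),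
    (∀ α β, mul α β = mul β α) ∧ ∀ (α β : V →L[ℝ] ℝ) (u : V), h.form u α β = mul α β u

end

noncomputable section

section ModelSpaceVersions

variable {E : Type*} [NormedAddCommGroup E] [NormedSpace ℝ E]
  {H : Type*} [TopologicalSpace H] {I : ModelWithCorners ℝ E H}
  {M : Type*} [TopologicalSpace M] [ChartedSpace H M]
  {E' : Type*} [NormedAddCommGroup E'] [NormedSpace ℝ E']
  {H' : Type*} [TopologicalSpace H'] {J : ModelWithCorners ℝ E' H'}
  {N : Type*} [TopologicalSpace N] [ChartedSpace H' N]

/-- The manifold derivative, as a map between the model spaces. -/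
def modelDeriv (I : ModelWithCorners ℝ E H) (J : ModelWithCorners ℝ E' H') (f : M → N) (x : M) :
    E →L[ℝ] E' :=
  mfderiv I J f x

/-- The covariant derivative, as a map on the model space. -/
def AffineConnection.modelCov [IsManifold I 1 M] (cov : AffineConnection I M)
    (Y : Π x : M, TangentSpace I x) (x : M) : E →L[ℝ] E :=
  cov Y x

lemma modelDeriv_comp {E'' : Type*} [NormedAddCommGroup E''] [NormedSpace ℝ E'']
    {H'' : Type*} [TopologicalSpace H''] {K : ModelWithCorners ℝ E'' H''}
    {P : Type*} [TopologicalSpace P] [ChartedSpace H'' P] {g : N → P} {f : M → N} {x : M}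
    (hg : MDifferentiableAt J K g (f x)) (hf : MDifferentiableAt I J f x) (v : E) :
    modelDeriv I K (fun y => g (f y)) x v = modelDeriv J K g (f x) (modelDeriv I J f x v) :=
  mfderiv_comp_apply x hg hf v

lemma modelDeriv_id (x : M) (v : E) : modelDeriv I I (fun y : M => y) x v = v :=
  congrArg (fun L : E →L[ℝ] E => L v) (mfderiv_id (I := I) (x := x))

lemma modelDeriv_const (c : N) (x : M) (v : E) : modelDeriv I J (fun _ : M => c) x v = 0 :=
  congrArg (fun L : E →L[ℝ] E' => L v) (mfderiv_const (I := I) (I' := J) (x := x) (c := c))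

lemma tangentBundle_mk_congr {x y : M} (h : x = y) (w : E) :
    (⟨x, w⟩ : TangentBundle I M) = ⟨y, w⟩ := by
  subst h; rfl

end ModelSpaceVersions

section LieGroupPreliminaries

variable {E : Type*} [NormedAddCommGroup E] [NormedSpace ℝ E]
  {H : Type*} [TopologicalSpace H] {I : ModelWithCorners ℝ E H}
  {G : Type*} [TopologicalSpace G] [ChartedSpace H G] [Group G]

/-- The derivative of the left translation by `a` at `x`. -/
def derivMulLeft (I : ModelWithCorners ℝ E H) (a x : G) : E →L[ℝ] E :=
  modelDeriv I I (fun g => a * g) x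

/-- The derivative of the right translation by `a` at `x`. -/
def derivMulRight (I : ModelWithCorners ℝ E H) (a x : G) : E →L[ℝ] E :=
  modelDeriv I I (fun g => g * a) x

lemma derivMulLeft_one (x : G) (w : E) : derivMulLeft I 1 x w = w := by
  unfold derivMulLeft
  simp only [one_mul, modelDeriv_id]

lemma derivMulRight_one (x : G) (w : E) : derivMulRight I 1 x w = w := by
  unfold derivMulRight
  simp only [mul_one, modelDeriv_id]

variable [LieGroup I ∞ G]

lemma mdifferentiableAt_mulLeft (a x : G) : MDifferentiableAt I I (fun g : G => a * g) x :=
  (contMDiff_mul_left (n := ∞)).mdifferentiableAt (by simp)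

lemma mdifferentiableAt_mulRight (a x : G) : MDifferentiableAt I I (fun g : G => g * a) x :=
  (contMDiff_mul_right (n := ∞)).mdifferentiableAt (by simp)

lemma mdifferentiableAt_mul (p : G × G) :
    MDifferentiableAt (I.prod I) I (fun p : G × G => p.1 * p.2) p :=
  (contMDiff_mul I ∞).mdifferentiableAt (by simp)

lemma modelDeriv_mul (p : G × G) (u v : E) :
    modelDeriv (I.prod I) I (fun p : G × G => p.1 * p.2) p (u, v) =
      derivMulRight I p.2 p.1 u + derivMulLeft I p.1 p.2 v :=
  mfderiv_prod_eq_add_apply (mdifferentiableAt_mul p)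

lemma derivMulLeft_derivMulLeft (a b x : G) (w : E) :
    derivMulLeft I a (b * x) (derivMulLeft I b x w) = derivMulLeft I (a * b) x w := by
  have h := modelDeriv_comp (mdifferentiableAt_mulLeft (I := I) a (b * x))
    (mdifferentiableAt_mulLeft b x) w
  unfold derivMulLeft
  simp only [← h, mul_assoc]

lemma derivMulRight_derivMulRight (a b x : G) (w : E) :
    derivMulRight I a (x * b) (derivMulRight I b x w) = derivMulRight I (b * a) x w := by
  have h := modelDeriv_comp (f := fun g => g * b) (mdifferentiableAt_mulRight (I := I) a (x * b))
    (mdifferentiableAt_mulRight b x) w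
  unfold derivMulRight
  simp only [← h, mul_assoc]

lemma derivMulLeft_inv_derivMulLeft (a x : G) (w : E) :
    derivMulLeft I a⁻¹ (a * x) (derivMulLeft I a x w) = w := by
  rw [derivMulLeft_derivMulLeft, inv_mul_cancel, derivMulLeft_one]

lemma derivMulLeft_derivMulLeft_inv (a x : G) (w : E) :
    derivMulLeft I a x (derivMulLeft I a⁻¹ (a * x) w) = w := by
  have h := derivMulLeft_derivMulLeft (I := I) a a⁻¹ (a * x) w
  rwa [inv_mul_cancel_left, mul_inv_cancel, derivMulLeft_one] at h

lemma derivMulRight_inv_derivMulRight (a x : G) (w : E) :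
    derivMulRight I a⁻¹ (x * a) (derivMulRight I a x w) = w := by
  rw [derivMulRight_derivMulRight, mul_inv_cancel, derivMulRight_one]

lemma derivMulRight_derivMulRight_inv (a x : G) (w : E) :
    derivMulRight I a x (derivMulRight I a⁻¹ (x * a) w) = w := by
  have h := derivMulRight_derivMulRight (I := I) a a⁻¹ (x * a) w
  rwa [mul_inv_cancel_right, inv_mul_cancel, derivMulRight_one] at h

end LieGroupPreliminaries

section TangentMul

variable {E : Type*} [NormedAddCommGroup E] [NormedSpace ℝ E]
  {H : Type*} [TopologicalSpace H] {I : ModelWithCorners ℝ E H}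
  {G : Type*} [TopologicalSpace G] [ChartedSpace H G] [Group G] [LieGroup I ∞ G]
  {E' : Type*} [NormedAddCommGroup E'] [NormedSpace ℝ E']
  {H' : Type*} [TopologicalSpace H'] {J : ModelWithCorners ℝ E' H'}
  {N : Type*} [TopologicalSpace N] [ChartedSpace H' N]

lemma contMDiffAt_tangent_mulLeft {a b : N → G} {w : N → E} {x : N}
    (ha : ContMDiffAt J I ∞ a x)
    (hb : ContMDiffAt J I.tangent ∞ (fun p => (⟨b p, w p⟩ : TangentBundle I G)) x) :
    ContMDiffAt J I.tangent ∞
      (fun p => (⟨a p * b p, derivMulLeft I (a p) (b p) (w p)⟩ : TangentBundle I G)) x := by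
  have h0 : ContMDiffAt J I.tangent ∞ (fun p => (⟨a p, (0 : E)⟩ : TangentBundle I G)) x :=
    (Bundle.contMDiff_zeroSection ℝ (TangentSpace I : G → Type _)).contMDiffAt.comp x ha
  have h1 := (contMDiff_equivTangentBundleProd_symm (I := I) (M := G) (I' := I) (M' := G)
    (n := ∞)).contMDiffAt.comp x (h0.prodMk hb)
  have h2 := ((contMDiff_mul I ∞ (G := G)).contMDiff_tangentMap (m := ∞)
    (by simp)).contMDiffAt.comp x h1
  convert h2 using 2 with p
  refine congrArg (fun z : E => (⟨a p * b p, z⟩ : TangentBundle I G)) ?_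
  have := modelDeriv_mul (I := I) (a p, b p) 0 (w p)
  rw [map_zero, zero_add] at this
  exact this.symm

lemma contMDiffAt_tangent_mulRight {a b : N → G} {w : N → E} {x : N}
    (ha : ContMDiffAt J I ∞ a x)
    (hb : ContMDiffAt J I.tangent ∞ (fun p => (⟨b p, w p⟩ : TangentBundle I G)) x) :
    ContMDiffAt J I.tangent ∞
      (fun p => (⟨b p * a p, derivMulRight I (a p) (b p) (w p)⟩ : TangentBundle I G)) x := by
  have h0 : ContMDiffAt J I.tangent ∞ (fun p => (⟨a p, (0 : E)⟩ : TangentBundle I G)) x :=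
    (Bundle.contMDiff_zeroSection ℝ (TangentSpace I : G → Type _)).contMDiffAt.comp x ha
  have h1 := (contMDiff_equivTangentBundleProd_symm (I := I) (M := G) (I' := I) (M' := G)
    (n := ∞)).contMDiffAt.comp x (hb.prodMk h0)
  have h2 := ((contMDiff_mul I ∞ (G := G)).contMDiff_tangentMap (m := ∞)
    (by simp)).contMDiffAt.comp x h1
  convert h2 using 2 with p
  refine congrArg (fun z : E => (⟨b p * a p, z⟩ : TangentBundle I G)) ?_
  have := modelDeriv_mul (I := I) (b p, a p) (w p) 0
  rw [map_zero, add_zero] at this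
  exact this.symm

/-- The left-invariant vector field with value `v` at `1`. -/
def leftInvariantField (I : ModelWithCorners ℝ E H) {G : Type*} [TopologicalSpace G]
    [ChartedSpace H G] [Group G] (v : E) (g : G) : TangentSpace I g :=
  derivMulLeft I g 1 v

lemma smoothFieldAt_leftInvariantField (v : E) (g : G) :
    SmoothFieldAt I (leftInvariantField I v : Π g : G, TangentSpace I g) g := by
  have h := contMDiffAt_tangent_mulLeft (J := I) (I := I) (a := fun g : G => g)
    (b := fun _ : G => (1 : G)) (w := fun _ => v) (x := g) contMDiffAt_id contMDiffAt_const
  unfold SmoothFieldAt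
  convert h using 2 with p
  exact tangentBundle_mk_congr (mul_one p).symm _

lemma derivMulLeft_leftInvariantField (a g : G) (v : E) :
    derivMulLeft I a g (leftInvariantField I v g) = leftInvariantField I v (a * g) := by
  have h := derivMulLeft_derivMulLeft (I := I) a g 1 v
  rw [mul_one] at h
  exact h

end TangentMul

section AffineMul

variable {E : Type*} [NormedAddCommGroup E] [NormedSpace ℝ E]
  {H : Type*} [TopologicalSpace H] {I : ModelWithCorners ℝ E H}
  {G : Type*} [TopologicalSpace G] [ChartedSpace H G] [Group G]

/-- The lift `(0, dL_g⁻¹ Y(gh))` to `G × G` of a vector field `Y` along the multiplication. -/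
def liftRightFactor (Y : Π g : G, TangentSpace I g) (p : G × G) : TangentSpace (I.prod I) p :=
  ((0 : E), derivMulLeft I p.1⁻¹ (p.1 * p.2) (Y (p.1 * p.2)))

/-- The lift `(dR_h⁻¹ Y(gh), 0)` to `G × G` of a vector field `Y` along the multiplication. -/
def liftLeftFactor (Y : Π g : G, TangentSpace I g) (p : G × G) : TangentSpace (I.prod I) p :=
  (derivMulRight I p.2⁻¹ (p.1 * p.2) (Y (p.1 * p.2)), (0 : E))

variable [LieGroup I ∞ G]

lemma mfderiv_mul_liftRightFactor (Y : Π g : G, TangentSpace I g) (p : G × G) :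
    mfderiv (I.prod I) I (fun p : G × G => p.1 * p.2) p (liftRightFactor Y p) =
      Y (p.1 * p.2) := by
  have h := modelDeriv_mul (I := I) p 0 (derivMulLeft I p.1⁻¹ (p.1 * p.2) (Y (p.1 * p.2)))
  rw [map_zero, zero_add] at h
  exact h.trans (derivMulLeft_derivMulLeft_inv _ _ _)

lemma mfderiv_mul_liftLeftFactor (Y : Π g : G, TangentSpace I g) (p : G × G) :
    mfderiv (I.prod I) I (fun p : G × G => p.1 * p.2) p (liftLeftFactor Y p) =
      Y (p.1 * p.2) := by
  have h := modelDeriv_mul (I := I) p (derivMulRight I p.2⁻¹ (p.1 * p.2) (Y (p.1 * p.2))) 0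
  rw [map_zero, add_zero] at h
  exact h.trans (derivMulRight_derivMulRight_inv _ _ _)

lemma SmoothFieldAt.comp_mul {Y : Π g : G, TangentSpace I g} {p : G × G}
    (hY : SmoothFieldAt I Y (p.1 * p.2)) : ContMDiffAt (I.prod I) I.tangent ∞
      (fun q : G × G => (⟨q.1 * q.2, Y (q.1 * q.2)⟩ : TangentBundle I G)) p :=
  ContMDiffAt.comp p (g := fun g => (⟨g, Y g⟩ : TangentBundle I G)) hY
    (contMDiff_mul I ∞).contMDiffAt

lemma smoothFieldAt_liftRightFactor {Y : Π g : G, TangentSpace I g} {p : G × G}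
    (hY : SmoothFieldAt I Y (p.1 * p.2)) :
    SmoothFieldAt (I.prod I) (liftRightFactor Y) p := by
  have h1 := contMDiffAt_tangent_mulLeft (J := I.prod I) (I := I)
    (a := fun q : G × G => q.1⁻¹) (b := fun q => q.1 * q.2)
    (w := fun q => Y (q.1 * q.2)) (x := p) contMDiffAt_fst.inv hY.comp_mul
  have h0 : ContMDiffAt (I.prod I) I.tangent ∞
      (fun q : G × G => (⟨q.1, (0 : E)⟩ : TangentBundle I G)) p :=
    (Bundle.contMDiff_zeroSection ℝ (TangentSpace I : G → Type _)).contMDiffAt.comp p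
      contMDiffAt_fst
  have h2 := (contMDiff_equivTangentBundleProd_symm (I := I) (M := G) (I' := I) (M' := G)
    (n := ∞)).contMDiffAt.comp p (h0.prodMk h1)
  unfold SmoothFieldAt
  convert h2 using 2 with q
  have e := tangentBundle_mk_congr (I := I) (inv_mul_cancel_left q.1 q.2)
    (derivMulLeft I q.1⁻¹ (q.1 * q.2) (Y (q.1 * q.2)))
  simp only [Function.comp]
  rw [e]
  rfl

lemma smoothFieldAt_liftLeftFactor {Y : Π g : G, TangentSpace I g} {p : G × G}
    (hY : SmoothFieldAt I Y (p.1 * p.2)) :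
    SmoothFieldAt (I.prod I) (liftLeftFactor Y) p := by
  have h1 := contMDiffAt_tangent_mulRight (J := I.prod I) (I := I)
    (a := fun q : G × G => q.2⁻¹) (b := fun q => q.1 * q.2)
    (w := fun q => Y (q.1 * q.2)) (x := p) contMDiffAt_snd.inv hY.comp_mul
  have h0 : ContMDiffAt (I.prod I) I.tangent ∞
      (fun q : G × G => (⟨q.2, (0 : E)⟩ : TangentBundle I G)) p :=
    (Bundle.contMDiff_zeroSection ℝ (TangentSpace I : G → Type _)).contMDiffAt.comp p
      contMDiffAt_snd
  have h2 := (contMDiff_equivTangentBundleProd_symm (I := I) (M := G) (I' := I) (M' := G)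
    (n := ∞)).contMDiffAt.comp p (h1.prodMk h0)
  unfold SmoothFieldAt
  convert h2 using 2 with q
  have e := tangentBundle_mk_congr (I := I) (mul_inv_cancel_right q.1 q.2)
    (derivMulRight I q.2⁻¹ (q.1 * q.2) (Y (q.1 * q.2)))
  simp only [Function.comp]
  rw [e]
  rfl

variable {cov : AffineConnection I G}

lemma MulPreservesConnection.modelCov_of_liftRight (hm : MulPreservesConnection cov) {a b : G}
    {Y : Π g : G, TangentSpace I g} (hY : SmoothFieldAt I Y (a * b)) (u v : E) :
    cov.modelCov Y (a * b) (derivMulRight I b a u + derivMulLeft I a b v) =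
      derivMulLeft I a b
        (modelDeriv I 𝓘(ℝ, E) (fun g => derivMulLeft I g⁻¹ (g * b) (Y (g * b))) a u +
          cov.modelCov (fun h => derivMulLeft I a⁻¹ (a * h) (Y (a * h))) b v) := by
  have h := hm.map_cov (a, b) (liftRightFactor Y) Y (smoothFieldAt_liftRightFactor hY) hY
    (Filter.Eventually.of_forall (mfderiv_mul_liftRightFactor Y)) ((u, v) : E × E)
  have z1 : cov.modelCov (fun _ : G => (0 : E)) a = 0 := congrFun cov.zero a
  have z2 := modelDeriv_const (I := I) (J := 𝓘(ℝ, E)) (0 : E) b v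
  have e1 := modelDeriv_mul (I := I) (a, b) u v
  have e2 := modelDeriv_mul (I := I) (a, b)
    (cov.modelCov (fun _ : G => (0 : E)) a u + modelDeriv I 𝓘(ℝ, E) (fun _ : G => (0 : E)) b v)
    (modelDeriv I 𝓘(ℝ, E) (fun g => derivMulLeft I g⁻¹ (g * b) (Y (g * b))) a u +
      cov.modelCov (fun h => derivMulLeft I a⁻¹ (a * h) (Y (a * h))) b v)
  have h' := (e2.symm.trans h).trans (congrArg (cov.modelCov Y (a * b)) e1)
  rw [z1, z2] at h'
  simp only [zero_apply, add_zero, map_zero, zero_add] at h'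
  exact h'.symm

lemma MulPreservesConnection.modelCov_of_liftLeft (hm : MulPreservesConnection cov) {a b : G}
    {Y : Π g : G, TangentSpace I g} (hY : SmoothFieldAt I Y (a * b)) (u v : E) :
    cov.modelCov Y (a * b) (derivMulRight I b a u + derivMulLeft I a b v) =
      derivMulRight I b a
        (cov.modelCov (fun g => derivMulRight I b⁻¹ (g * b) (Y (g * b))) a u +
          modelDeriv I 𝓘(ℝ, E) (fun h => derivMulRight I h⁻¹ (a * h) (Y (a * h))) b v) := by
  have h := hm.map_cov (a, b) (liftLeftFactor Y) Y (smoothFieldAt_liftLeftFactor hY) hY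
    (Filter.Eventually.of_forall (mfderiv_mul_liftLeftFactor Y)) ((u, v) : E × E)
  have z1 : cov.modelCov (fun _ : G => (0 : E)) b = 0 := congrFun cov.zero b
  have z2 := modelDeriv_const (I := I) (J := 𝓘(ℝ, E)) (0 : E) a u
  have e1 := modelDeriv_mul (I := I) (a, b) u v
  have e2 := modelDeriv_mul (I := I) (a, b)
    (cov.modelCov (fun g => derivMulRight I b⁻¹ (g * b) (Y (g * b))) a u +
      modelDeriv I 𝓘(ℝ, E) (fun h => derivMulRight I h⁻¹ (a * h) (Y (a * h))) b v)
    (modelDeriv I 𝓘(ℝ, E) (fun _ : G => (0 : E)) a u + cov.modelCov (fun _ : G => (0 : E)) b v)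
  have h' := (e2.symm.trans h).trans (congrArg (cov.modelCov Y (a * b)) e1)
  rw [z1, z2] at h'
  simp only [zero_apply, add_zero, map_zero] at h'
  exact h'.symm

end AffineMul

end

noncomputable section

section LocallyConstant

variable {E : Type*} [NormedAddCommGroup E] [NormedSpace ℝ E]
  {M : Type*} [TopologicalSpace M] [ChartedSpace E M] [IsManifold 𝓘(ℝ, E) 1 M]
  {E' : Type*} [NormedAddCommGroup E'] [NormedSpace ℝ E']
  {H' : Type*} [TopologicalSpace H'] {J : ModelWithCorners ℝ E' H'}
  {N : Type*} [TopologicalSpace N] [ChartedSpace H' N] [IsManifold J 1 N]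

lemma isLocallyConstant_of_modelDeriv_eq_zero {f : M → N} (hf : MDifferentiable 𝓘(ℝ, E) J f)
    (h0 : ∀ x v, modelDeriv 𝓘(ℝ, E) J f x v = 0) : IsLocallyConstant f := by
  refine IsLocallyConstant.iff_eventually_eq f |>.2 fun x => ?_
  set φ := extChartAt 𝓘(ℝ, E) x with hφ
  set ψ := extChartAt J (f x) with hψ
  have hφt : IsOpen φ.target := isOpen_extChartAt_target x
  have hcont : ContinuousAt (fun z => f (φ.symm z)) (φ x) := by
    refine ContinuousAt.comp ?_ (continuousAt_extChartAt_symm x)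
    exact hf.continuous.continuousAt
  have hmem : ∀ᶠ z in 𝓝 (φ x), z ∈ φ.target ∧ f (φ.symm z) ∈ ψ.source := by
    refine (hφt.eventually_mem (mem_extChartAt_target x)).and ?_
    refine hcont.eventually_mem ?_
    simp only [hφ, extChartAt_to_inv]
    exact extChartAt_source_mem_nhds (f x)
  obtain ⟨r, hr, hball⟩ := Metric.eventually_nhds_iff_ball.1 hmem
  have hd : ∀ z ∈ Metric.ball (φ x) r,
      HasFDerivAt (fun z => ψ (f (φ.symm z))) (0 : E →L[ℝ] E') z := by
    intro z hz
    obtain ⟨hz1, hz2⟩ := hball z hz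
    have d1 : MDifferentiableAt 𝓘(ℝ, E) 𝓘(ℝ, E) φ.symm z :=
      ((contMDiffOn_extChartAt_symm (n := 1) x).contMDiffAt
        (hφt.mem_nhds hz1)).mdifferentiableAt (by simp)
    have d2 := (hf (φ.symm z)).comp z d1
    have d3 : MDifferentiableAt J 𝓘(ℝ, E') ψ (f (φ.symm z)) :=
      (contMDiffAt_extChartAt' (n := 1) (by simpa [hψ] using hz2)).mdifferentiableAt (by simp)
    have d4 := d3.comp z d2
    have hdd := d4.differentiableAt
    have e : fderiv ℝ (fun z => ψ (f (φ.symm z))) z = 0 := by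
      ext v
      have h1 := modelDeriv_comp (g := ψ) (f := fun z => f (φ.symm z)) d3 d2 v
      have h2 := modelDeriv_comp (g := f) (f := φ.symm) (hf (φ.symm z)) d1 v
      rw [h2, h0, map_zero] at h1
      exact (congrArg (fun L : E →L[ℝ] E' => L v) mfderiv_eq_fderiv.symm).trans h1
    exact e ▸ hdd.hasFDerivAt
  have hconst : ∀ z ∈ Metric.ball (φ x) r, ψ (f (φ.symm z)) = ψ (f x) := by
    intro z hz
    have := (convex_ball (φ x) r).is_const_of_fderivWithin_eq_zero
      (f := fun z => ψ (f (φ.symm z))) (𝕜 := ℝ)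
      (fun w hw => (hd w hw).differentiableAt.differentiableWithinAt)
      (fun w hw => (hd w hw).hasFDerivWithinAt.fderivWithin
        (Metric.isOpen_ball.uniqueDiffWithinAt hw))
      hz (Metric.mem_ball_self hr)
    simpa only [hφ, extChartAt_to_inv] using this
  have hx : ∀ᶠ y in 𝓝 x, φ y ∈ Metric.ball (φ x) r ∧ y ∈ φ.source :=
    ((continuousAt_extChartAt x).eventually_mem (Metric.ball_mem_nhds _ hr)).and
      (extChartAt_source_mem_nhds x)
  filter_upwards [hx] with y hy
  have h1 := hconst _ hy.1
  have h2 := (hball _ hy.1).2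
  rw [φ.left_inv hy.2] at h1 h2
  exact ψ.injOn h2 (mem_extChartAt_source (f x)) h1

lemma eq_of_modelDeriv_eq_zero [PreconnectedSpace M] {f : M → N}
    (hf : MDifferentiable 𝓘(ℝ, E) J f)
    (h0 : ∀ x v, modelDeriv 𝓘(ℝ, E) J f x v = 0) (x y : M) : f x = f y :=
  (isLocallyConstant_of_modelDeriv_eq_zero hf h0).apply_eq_of_preconnectedSpace x y

end LocallyConstant

section BiInvariant

variable {E : Type*} [NormedAddCommGroup E] [NormedSpace ℝ E]
  {H : Type*} [TopologicalSpace H] {I : ModelWithCorners ℝ E H}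
  {G : Type*} [TopologicalSpace G] [ChartedSpace H G] [Group G] [LieGroup I ∞ G]
  {cov : AffineConnection I G}

lemma SmoothFieldAt.mdifferentiableAt {E : Type*} [NormedAddCommGroup E] [NormedSpace ℝ E]
    {H : Type*} [TopologicalSpace H] {I : ModelWithCorners ℝ E H}
    {M : Type*} [TopologicalSpace M] [ChartedSpace H M] [IsManifold I 1 M]
    {Y : Π x : M, TangentSpace I x} {x : M} (hY : SmoothFieldAt I Y x) :
    MDifferentiableAt I I.tangent (fun y => (⟨y, Y y⟩ : TangentBundle I M)) x :=
  ContMDiffAt.mdifferentiableAt hY (by simp)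

theorem MulPreservesConnection.isBiInvariant (hm : MulPreservesConnection cov) :
    IsBiInvariant cov := by
  refine fun a => ⟨⟨contMDiff_mul_left, fun x Y Y' hY hY' hrel v => ?_⟩,
    ⟨contMDiff_mul_right, fun x Y Y' hY hY' hrel v => ?_⟩⟩
  · have h := hm.modelCov_of_liftRight (a := a) (b := x) hY' 0 v
    rw [map_zero, map_zero, zero_add, zero_add] at h
    have hd := mdifferentiableAt_slice22
      (smoothFieldAt_liftRightFactor (p := (a, x)) hY').mdifferentiableAt
    have hc := cov.isCovariantDerivativeOnUniv.congr_of_eventuallyEq hY.mdifferentiableAt hd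
      Filter.univ_mem (hrel.mono fun z hz => by
        have h1 := derivMulLeft_inv_derivMulLeft (I := I) a z (Y z)
        exact h1.symm.trans (congrArg (derivMulLeft I a⁻¹ (a * z)) hz))
    exact (congrArg (fun L : E →L[ℝ] E => derivMulLeft I a x (L v)) hc).trans h.symm
  · have h := hm.modelCov_of_liftLeft (a := x) (b := a) hY' v 0
    rw [map_zero, map_zero, add_zero, add_zero] at h
    have hd := mdifferentiableAt_slice11
      (smoothFieldAt_liftLeftFactor (p := (x, a)) hY').mdifferentiableAt
    have hc := cov.isCovariantDerivativeOnUniv.congr_of_eventuallyEq hY.mdifferentiableAt hd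
      Filter.univ_mem (hrel.mono fun z hz => by
        have h1 := derivMulRight_inv_derivMulRight (I := I) a z (Y z)
        exact h1.symm.trans (congrArg (derivMulRight I a⁻¹ (z * a)) hz))
    exact (congrArg (fun L : E →L[ℝ] E => derivMulRight I a x (L v)) hc).trans h.symm

/-- The covariant derivative in the left trivialization of the tangent bundle is the ordinary
derivative. -/
lemma MulPreservesConnection.modelCov_eq (hm : MulPreservesConnection cov) {a : G}
    {Y : Π g : G, TangentSpace I g} (hY : SmoothFieldAt I Y a) (u : E) :
    cov.modelCov Y a u =
      derivMulLeft I a 1 (modelDeriv I 𝓘(ℝ, E) (fun g => derivMulLeft I g⁻¹ g (Y g)) a u) := by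
  have h := hm.modelCov_of_liftRight (a := a) (b := 1) (by simpa using hY) u 0
  simp only [map_zero, add_zero, derivMulRight_one] at h
  rw [mul_one] at h
  convert h using 5 with g
  rw [mul_one]

lemma MulPreservesConnection.modelCov_leftInvariantField (hm : MulPreservesConnection cov)
    (X : E) (a : G) (u : E) : cov.modelCov (leftInvariantField I X) a u = 0 := by
  rw [hm.modelCov_eq (smoothFieldAt_leftInvariantField X a)]
  have h : (fun g : G => derivMulLeft I g⁻¹ g (leftInvariantField I X g)) = fun _ => X := by
    funext g
    have h1 := derivMulLeft_inv_derivMulLeft (I := I) g 1 X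
    rwa [mul_one] at h1
  rw [h, modelDeriv_const, map_zero]

end BiInvariant

section Abelian

variable {E : Type*} [NormedAddCommGroup E] [NormedSpace ℝ E]
  {G : Type*} [TopologicalSpace G] [ChartedSpace E G] [Group G] [LieGroup 𝓘(ℝ, E) ∞ G]
  {cov : AffineConnection 𝓘(ℝ, E) G}

lemma MulPreservesConnection.derivMulLeft_eq_derivMulRight [PreconnectedSpace G]
    (hm : MulPreservesConnection cov) (h : G) (X : E) :
    derivMulLeft 𝓘(ℝ, E) h 1 X = derivMulRight 𝓘(ℝ, E) h 1 X := by
  have hsm : ∀ b : G, SmoothFieldAt 𝓘(ℝ, E)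
      (leftInvariantField 𝓘(ℝ, E) X : Π g : G, TangentSpace 𝓘(ℝ, E) g) b :=
    smoothFieldAt_leftInvariantField X
  have hd : MDifferentiable 𝓘(ℝ, E) 𝓘(ℝ, E) (fun b : G =>
      derivMulRight 𝓘(ℝ, E) b⁻¹ (1 * b) (leftInvariantField 𝓘(ℝ, E) X (1 * b))) := fun b =>
    mdifferentiableAt_slice12
      (smoothFieldAt_liftLeftFactor (p := ((1 : G), b)) (hsm _)).mdifferentiableAt
  have h0 : ∀ b v, modelDeriv 𝓘(ℝ, E) 𝓘(ℝ, E) (fun b : G =>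
      derivMulRight 𝓘(ℝ, E) b⁻¹ (1 * b) (leftInvariantField 𝓘(ℝ, E) X (1 * b))) b v = 0 := by
    intro b v
    have h1 := hm.modelCov_of_liftLeft (a := 1) (b := b) (hsm _) 0 v
    rw [hm.modelCov_leftInvariantField, map_zero, zero_add] at h1
    have h2 := congrArg (derivMulRight 𝓘(ℝ, E) b⁻¹ (1 * b)) h1
    rw [derivMulRight_inv_derivMulRight, map_zero] at h2
    exact h2.symm
  have key := eq_of_modelDeriv_eq_zero hd h0 h 1
  have h3 : derivMulRight 𝓘(ℝ, E) h⁻¹ (1 * h) (derivMulLeft 𝓘(ℝ, E) (1 * h) 1 X) =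
      derivMulRight 𝓘(ℝ, E) (1 : G)⁻¹ (1 * 1) (derivMulLeft 𝓘(ℝ, E) ((1 : G) * 1) 1 X) := key
  rw [inv_one, derivMulRight_one, one_mul (1 : G), derivMulLeft_one, one_mul h] at h3
  have h4 := congrArg (derivMulRight 𝓘(ℝ, E) h 1) h3
  have h5 := derivMulRight_derivMulRight_inv (I := 𝓘(ℝ, E)) h 1 (derivMulLeft 𝓘(ℝ, E) h 1 X)
  rw [one_mul] at h5
  exact h5.symm.trans h4

lemma derivMulRight_derivMulLeft (a b x : G) (w : E) :
    derivMulRight 𝓘(ℝ, E) b (a * x) (derivMulLeft 𝓘(ℝ, E) a x w) =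
      derivMulLeft 𝓘(ℝ, E) a (x * b) (derivMulRight 𝓘(ℝ, E) b x w) := by
  have h1 := modelDeriv_comp (g := fun g => g * b) (f := fun g => a * g)
    (mdifferentiableAt_mulRight (I := 𝓘(ℝ, E)) b (a * x)) (mdifferentiableAt_mulLeft a x) w
  have h2 := modelDeriv_comp (g := fun g => a * g) (f := fun g => g * b)
    (mdifferentiableAt_mulLeft (I := 𝓘(ℝ, E)) a (x * b)) (mdifferentiableAt_mulRight b x) w
  unfold derivMulLeft derivMulRight
  rw [← h1, ← h2]
  simp only [mul_assoc]

/-- A connected Lie group with trivial adjoint representation is abelian. -/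
lemma mul_comm_of_derivMulLeft_eq_derivMulRight [PreconnectedSpace G]
    (hA : ∀ (h : G) (X : E), derivMulLeft 𝓘(ℝ, E) h 1 X = derivMulRight 𝓘(ℝ, E) h 1 X)
    (a b : G) : a * b = b * a := by
  have hs : ContMDiff 𝓘(ℝ, E) 𝓘(ℝ, E) ∞ (fun x : G => x⁻¹ * (a * x)) :=
    (contMDiff_inv 𝓘(ℝ, E) ∞).mul contMDiff_mul_left
  have hd : MDifferentiable 𝓘(ℝ, E) 𝓘(ℝ, E) (fun x : G => x⁻¹ * (a * x)) :=
    hs.mdifferentiable (by simp)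
  have h0 : ∀ x v, modelDeriv 𝓘(ℝ, E) 𝓘(ℝ, E) (fun x : G => x⁻¹ * (a * x)) x v = 0 := by
    intro x v
    set D := modelDeriv 𝓘(ℝ, E) 𝓘(ℝ, E) (fun x : G => x⁻¹ * (a * x)) x v with hD
    set k := x⁻¹ * (a * x) with hk
    have hpair := modelDeriv_comp (I := 𝓘(ℝ, E)) (J := 𝓘(ℝ, E).prod 𝓘(ℝ, E)) (K := 𝓘(ℝ, E))
      (g := fun p : G × G => p.1 * p.2) (f := fun x : G => (x, x⁻¹ * (a * x))) (x := x)
      (mdifferentiableAt_mul _) (mdifferentiableAt_id.prodMk (hd x)) v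
    have hp : modelDeriv 𝓘(ℝ, E) (𝓘(ℝ, E).prod 𝓘(ℝ, E)) (fun x : G => (x, x⁻¹ * (a * x))) x v =
        (v, D) := by
      have := mfderiv_prodMk (mdifferentiableAt_id (I := 𝓘(ℝ, E)) (x := x)) (hd x)
      have h2 := congrArg (fun L : E →L[ℝ] E × E => L v) this
      refine h2.trans ?_
      exact Prod.ext (modelDeriv_id (I := 𝓘(ℝ, E)) x v) rfl
    rw [hp, modelDeriv_mul] at hpair
    have hL : modelDeriv 𝓘(ℝ, E) 𝓘(ℝ, E) (fun y : G => y * (y⁻¹ * (a * y))) x v =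
        derivMulLeft 𝓘(ℝ, E) a x v := by
      unfold derivMulLeft
      simp only [mul_inv_cancel_left]
    have hpair' : derivMulLeft 𝓘(ℝ, E) a x v =
        derivMulRight 𝓘(ℝ, E) k x v + derivMulLeft 𝓘(ℝ, E) x k D := hL.symm.trans hpair
    obtain ⟨w, rfl⟩ : ∃ w, derivMulLeft 𝓘(ℝ, E) x 1 w = v :=
      ⟨_, derivMulLeft_derivMulLeft_inv x 1 v⟩
    have e1 : derivMulLeft 𝓘(ℝ, E) a x (derivMulLeft 𝓘(ℝ, E) x 1 w) =
        derivMulRight 𝓘(ℝ, E) k x (derivMulLeft 𝓘(ℝ, E) x 1 w) := by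
      have r1 := derivMulLeft_derivMulLeft (I := 𝓘(ℝ, E)) a x 1 w
      have r2 := derivMulRight_derivMulLeft (E := E) x k 1 w
      have r3 := derivMulLeft_derivMulLeft (I := 𝓘(ℝ, E)) x k 1 w
      rw [mul_one] at r1 r2 r3
      rw [one_mul] at r2
      rw [r1, r2, ← hA, r3, hk, mul_inv_cancel_left]
    rw [e1, left_eq_add] at hpair'
    have := congrArg (derivMulLeft 𝓘(ℝ, E) x⁻¹ (x * k)) hpair'
    rwa [derivMulLeft_inv_derivMulLeft, map_zero] at this
  have key := eq_of_modelDeriv_eq_zero hd h0 b 1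
  simp only [inv_one, mul_one, one_mul] at key
  rw [inv_mul_eq_iff_eq_mul] at key
  exact key

theorem MulPreservesConnection.mul_comm [PreconnectedSpace G] (hm : MulPreservesConnection cov)
    (a b : G) : a * b = b * a :=
  mul_comm_of_derivMulLeft_eq_derivMulRight hm.derivMulLeft_eq_derivMulRight a b

end Abelian

end

noncomputable section

lemma contDiffAt_of_eventually_hasDerivAt {E : Type*} [NormedAddCommGroup E] [NormedSpace ℝ E]
    {c : ℝ → E} {f : E → E} {t₀ : ℝ} (hc : ∀ᶠ t in 𝓝 t₀, HasDerivAt c (f (c t)) t)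
    (hf : ContDiffAt ℝ ∞ f (c t₀)) : ContDiffAt ℝ ∞ c t₀ := by
  refine contDiffAt_infty.2 fun n => ?_
  induction n with
  | zero =>
    refine contDiffAt_zero.2 ⟨_, hc, fun t ht => ?_⟩
    exact (HasDerivAt.continuousAt ht).continuousWithinAt
  | succ n ih =>
    refine contDiffAt_succ_iff_hasFDerivAt.2
      ⟨fun t => ContinuousLinearMap.toSpanSingleton ℝ (f (c t)),
        ⟨_, hc, fun t ht => HasDerivAt.hasFDerivAt ht⟩, ?_⟩
    have h := (contDiffAt_infty.1 hf n).comp t₀ ih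
    exact (ContinuousLinearMap.toSpanSingletonCLE (𝕜 := ℝ) (E := E)).contDiff.contDiffAt.comp t₀ h

section IntegralCurves

variable {E : Type*} [NormedAddCommGroup E] [NormedSpace ℝ E]
  {M : Type*} [TopologicalSpace M] [ChartedSpace E M] [IsManifold 𝓘(ℝ, E) ∞ M]

lemma IsMIntegralCurveAt.contMDiffAt {γ : ℝ → M} {v : Π x : M, TangentSpace 𝓘(ℝ, E) x} {t₀ : ℝ}
    (hγ : IsMIntegralCurveAt γ v t₀) (hv : SmoothFieldAt 𝓘(ℝ, E) v (γ t₀)) :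
    ContMDiffAt 𝓘(ℝ, ℝ) 𝓘(ℝ, E) ∞ γ t₀ := by
  refine contMDiffAt_iff_target.2 ⟨hγ.continuousAt, ?_⟩
  set f : E → E := fun x ↦
    tangentCoordChange 𝓘(ℝ, E) ((extChartAt 𝓘(ℝ, E) (γ t₀)).symm x) (γ t₀)
      ((extChartAt 𝓘(ℝ, E) (γ t₀)).symm x) (v ((extChartAt 𝓘(ℝ, E) (γ t₀)).symm x)) with hf
  have hfs : ContDiffAt ℝ ∞ f (extChartAt 𝓘(ℝ, E) (γ t₀) (γ t₀)) :=
    ((contMDiffAt_iff.1 hv).2.contDiffAt (by simp)).snd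
  have hsrc : ∀ᶠ t in 𝓝 t₀, γ t ∈ (extChartAt 𝓘(ℝ, E) (γ t₀)).source :=
    hγ.continuousAt.eventually_mem (extChartAt_source_mem_nhds (γ t₀))
  have hd : ∀ᶠ t in 𝓝 t₀, HasDerivAt (extChartAt 𝓘(ℝ, E) (γ t₀) ∘ γ)
      (f ((extChartAt 𝓘(ℝ, E) (γ t₀) ∘ γ) t)) t := by
    filter_upwards [hsrc, hγ.eventually_hasDerivAt] with t ht1 ht2
    refine ht2.congr_deriv ?_
    have e := (extChartAt 𝓘(ℝ, E) (γ t₀)).left_inv ht1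
    exact congrArg (fun z => (tangentCoordChange 𝓘(ℝ, E) z (γ t₀) z : E →L[ℝ] E) (v z)) e.symm
  exact (contDiffAt_of_eventually_hasDerivAt hd hfs).contMDiffAt

end IntegralCurves

section OneParameterSubgroups

variable {E : Type*} [NormedAddCommGroup E] [NormedSpace ℝ E]
  {G : Type*} [TopologicalSpace G] [ChartedSpace E G] [Group G] [LieGroup 𝓘(ℝ, E) ∞ G]

lemma t2Space_of_lieGroup (E : Type*) [NormedAddCommGroup E] [NormedSpace ℝ E]
    (G : Type*) [TopologicalSpace G] [ChartedSpace E G] [Group G] [LieGroup 𝓘(ℝ, E) ∞ G] :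
    T2Space G := by
  have := topologicalGroup_of_lieGroup 𝓘(ℝ, E) ∞ (G := G)
  have : T1Space G := ChartedSpace.t1Space E G
  infer_instance

lemma IsMIntegralCurveOn.mul_left {γ : ℝ → G} {X : E} {s : Set ℝ}
    (hγ : IsMIntegralCurveOn γ (leftInvariantField 𝓘(ℝ, E) X) s) (a : G) :
    IsMIntegralCurveOn (fun t => a * γ t) (leftInvariantField 𝓘(ℝ, E) X) s := by
  intro t ht
  have h := (mdifferentiableAt_mulLeft (I := 𝓘(ℝ, E)) a (γ t)).hasMFDerivAt.comp_hasMFDerivWithinAt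
    t (hγ t ht)
  refine HasMFDerivWithinAt.congr_mfderiv h ?_
  ext
  have h1 : derivMulLeft 𝓘(ℝ, E) a (γ t) ((1 : ℝ) • leftInvariantField 𝓘(ℝ, E) X (γ t)) =
      (1 : ℝ) • leftInvariantField 𝓘(ℝ, E) X (a * γ t) := by
    rw [one_smul, one_smul]
    exact derivMulLeft_leftInvariantField a (γ t) X
  exact h1

variable [CompleteSpace E]

/-- Existence of one-parameter subgroups of a Lie group. -/
lemma exists_oneParameterSubgroup (X : E) : ∃ γ : ℝ → G,
    ContMDiff 𝓘(ℝ, ℝ) 𝓘(ℝ, E) ∞ γ ∧ (∀ s t, γ (s + t) = γ s * γ t) ∧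
      modelDeriv 𝓘(ℝ, ℝ) 𝓘(ℝ, E) γ 0 1 = X := by
  have := t2Space_of_lieGroup E G
  set V : Π g : G, TangentSpace 𝓘(ℝ, E) g := leftInvariantField 𝓘(ℝ, E) X with hVdef
  have hV : ∀ g, SmoothFieldAt 𝓘(ℝ, E) V g := smoothFieldAt_leftInvariantField X
  have hV1 : ContMDiff 𝓘(ℝ, E) 𝓘(ℝ, E).tangent 1 (fun g => (⟨g, V g⟩ : TangentBundle 𝓘(ℝ, E) G)) :=
    fun g => (hV g).of_le (by simp)
  obtain ⟨γ₁, h1, h2⟩ :=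
    exists_isMIntegralCurveAt_of_contMDiffAt_boundaryless (t₀ := 0) (hV1 1)
  obtain ⟨ε, hε, h3⟩ := isMIntegralCurveAt_iff'.1 h2
  rw [Real.ball_eq_Ioo, zero_sub, zero_add] at h3
  obtain ⟨γ, hγ0, hγ⟩ := exists_isMIntegralCurve_of_isMIntegralCurveOn hV1 hε
    (fun x => ⟨fun t => x * γ₁ t, by simp [h1], h3.mul_left x⟩) 1
  refine ⟨γ, fun t => (hγ.isMIntegralCurveAt t).contMDiffAt (hV _), fun s t => ?_, ?_⟩
  · have e1 : IsMIntegralCurve (fun t => γ s * γ t) V :=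
      isMIntegralCurve_iff_isMIntegralCurveOn.2 ((hγ.isMIntegralCurveOn _).mul_left (γ s))
    have e2 := isMIntegralCurve_Ioo_eq_of_contMDiff_boundaryless (t₀ := 0) hV1
      (hγ.comp_add s) e1 (by simp [hγ0])
    have := congrFun e2 t
    simpa [add_comm] using this
  · have h := (hγ 0).mfderiv
    have h' : modelDeriv 𝓘(ℝ, ℝ) 𝓘(ℝ, E) γ 0 1 =
        (1 : ℝ) • derivMulLeft 𝓘(ℝ, E) (γ 0) 1 X :=
      congrArg (fun L : ℝ →L[ℝ] E => L 1) h
    rw [h', hγ0, one_smul, derivMulLeft_one]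

end OneParameterSubgroups

section Exponential

variable {E : Type*} [NormedAddCommGroup E] [NormedSpace ℝ E] [FiniteDimensional ℝ E]
  {G : Type*} [TopologicalSpace G] [ChartedSpace E G]

/-- The exponential map of an abelian Lie group. -/
lemma exists_exponential [CommGroup G] [LieGroup 𝓘(ℝ, E) ∞ G] : ∃ e : E → G,
    ContMDiff 𝓘(ℝ, E) 𝓘(ℝ, E) ∞ e ∧ (∀ x y, e (x + y) = e x * e y) ∧
      ∀ v, modelDeriv 𝓘(ℝ, E) 𝓘(ℝ, E) e 0 v = v := by
  have := FiniteDimensional.complete ℝ E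
  set b := Module.finBasis ℝ E
  choose γ hs hadd hd using fun i => exists_oneParameterSubgroup (G := G) (b i)
  have h0 : ∀ i, γ i 0 = 1 := fun i => by
    have := hadd i 0 0
    rwa [add_zero, left_eq_mul] at this
  have hsm : ContMDiff 𝓘(ℝ, E) 𝓘(ℝ, E) ∞ (fun x => ∏ i, γ i (b.coord i x)) := by
    refine contMDiff_finsetProd fun i _ => (hs i).comp ?_
    exact (LinearMap.toContinuousLinearMap (b.coord i)).contMDiff
  refine ⟨fun x => ∏ i, γ i (b.coord i x), hsm, fun x y => ?_, fun v => ?_⟩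
  · simp only [map_add, hadd, Finset.prod_mul_distrib]
  · suffices (modelDeriv 𝓘(ℝ, E) 𝓘(ℝ, E) (fun x => ∏ i, γ i (b.coord i x)) 0 : E →ₗ[ℝ] E) =
        LinearMap.id from LinearMap.congr_fun this v
    refine b.ext fun j => ?_
    have hl : HasMFDerivAt 𝓘(ℝ, ℝ) 𝓘(ℝ, E) (fun t : ℝ => t • b j) 0
        (ContinuousLinearMap.toSpanSingleton ℝ (b j)) :=
      (ContinuousLinearMap.toSpanSingleton ℝ (b j)).hasFDerivAt.hasMFDerivAt
    have h1 := modelDeriv_comp (I := 𝓘(ℝ, ℝ)) (f := fun t : ℝ => t • b j) (x := 0)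
      ((hsm ((0 : ℝ) • b j)).mdifferentiableAt (by simp)) hl.mdifferentiableAt 1
    have h2 : modelDeriv 𝓘(ℝ, ℝ) 𝓘(ℝ, E) (fun t : ℝ => t • b j) 0 1 = b j := by
      refine (congrArg (fun L : ℝ →L[ℝ] E => L 1) hl.mfderiv).trans ?_
      exact one_smul ℝ (b j)
    have h3 : (fun t : ℝ => ∏ i, γ i (b.coord i (t • b j))) = γ j := by
      funext t
      rw [Finset.prod_eq_single j]
      · simp
      · intro i _ hij
        simp [hij.symm, h0]
      · simp
    rw [h2, h3, hd, zero_smul] at h1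
    exact h1.symm

end Exponential

end

noncomputable section

section LocalInverse

variable {E : Type*} [NormedAddCommGroup E] [NormedSpace ℝ E] [CompleteSpace E]
  {M : Type*} [TopologicalSpace M] [ChartedSpace E M] [IsManifold 𝓘(ℝ, E) ∞ M]

/-- Inverse function theorem for maps from a Banach space to a manifold. -/
lemma exists_localInverse {e : E → M} {x : E} (he : ContMDiffAt 𝓘(ℝ, E) 𝓘(ℝ, E) ∞ e x)
    (hd : ∀ v, modelDeriv 𝓘(ℝ, E) 𝓘(ℝ, E) e x v = v) :
    𝓝 (e x) ≤ Filter.map e (𝓝 x) ∧ ∃ l : M → E,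
      ContMDiffAt 𝓘(ℝ, E) 𝓘(ℝ, E) ∞ l (e x) ∧ ∀ᶠ y in 𝓝 x, l (e y) = y := by
  set φ := extChartAt 𝓘(ℝ, E) (e x) with hφ
  have hφs : ContMDiffAt 𝓘(ℝ, E) 𝓘(ℝ, E) ∞ φ (e x) := contMDiffAt_extChartAt
  have hF : ContDiffAt ℝ ∞ (fun y => φ (e y)) x := (hφs.comp x he).contDiffAt
  obtain ⟨A, hA⟩ := isInvertible_mfderiv_extChartAt (I := 𝓘(ℝ, E))
    (mem_extChartAt_source (I := 𝓘(ℝ, E)) (e x))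
  let A' : E ≃L[ℝ] E := A
  have hF' : HasFDerivAt (fun y => φ (e y)) (A' : E →L[ℝ] E) x := by
    have h1 : fderiv ℝ (fun y => φ (e y)) x = (A' : E →L[ℝ] E) := by
      ext v
      have h2 := modelDeriv_comp (g := φ) (f := e) (hφs.mdifferentiableAt (by simp))
        (he.mdifferentiableAt (by simp)) v
      rw [hd] at h2
      refine (congrArg (fun L : E →L[ℝ] E => L v) mfderiv_eq_fderiv.symm).trans (h2.trans ?_)
      exact congrArg (fun L : E →L[ℝ] E => L v) hA.symm
    rw [← h1]
    exact (hF.differentiableAt (by simp)).hasFDerivAt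
  have hst := hF.hasStrictFDerivAt' hF' (by simp)
  refine ⟨?_, fun y => hF.localInverse hF' (by simp) (φ y), ?_, ?_⟩
  · intro s hs
    have hcont : ∀ᶠ y in 𝓝 x, e y ∈ φ.source :=
      he.continuousAt.eventually_mem (extChartAt_source_mem_nhds (e x))
    have h1 : (fun y => φ (e y)) '' (e ⁻¹' s ∩ {y | e y ∈ φ.source}) ∈ 𝓝 (φ (e x)) := by
      rw [← hst.map_nhds_eq_of_equiv]
      exact Filter.image_mem_map (Filter.inter_mem hs hcont)
    have h2 : φ ⁻¹' ((fun y => φ (e y)) '' (e ⁻¹' s ∩ {y | e y ∈ φ.source})) ∈ 𝓝 (e x) :=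
      (continuousAt_extChartAt (e x)).preimage_mem_nhds h1
    filter_upwards [h2, extChartAt_source_mem_nhds (I := 𝓘(ℝ, E)) (e x)] with z hz hz'
    obtain ⟨y, ⟨hy1, hy2⟩, hy3⟩ := hz
    rw [← φ.injOn hy2 hz' hy3]
    exact hy1
  · exact ContMDiffAt.comp (e x) (hF.to_localInverse hF' (by simp)).contMDiffAt hφs
  · exact hst.eventually_left_inverse

end LocalInverse

section Exponential

variable {E : Type*} [NormedAddCommGroup E] [NormedSpace ℝ E]
  {G : Type*} [TopologicalSpace G]

omit [NormedSpace ℝ E] in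
/-- A continuous, open and locally injective homomorphism from a normed group to a connected
group is a covering map. -/
lemma isCoveringMap_of_exponential [CommGroup G] [IsTopologicalGroup G] [ConnectedSpace G]
    {e : E → G} (hc : Continuous e) (hadd : ∀ x y, e (x + y) = e x * e y)
    (hopen : 𝓝 1 ≤ Filter.map e (𝓝 0)) (hinj : ∃ l : G → E, ∀ᶠ y in 𝓝 0, l (e y) = y) :
    IsCoveringMap e := by
  have he0 : e 0 = 1 := by
    have := hadd 0 0
    rwa [add_zero, left_eq_mul] at this
  let f : E →+ Additive G :=
    { toFun := fun x => Additive.ofMul (e x)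
      map_zero' := by rw [he0]; rfl
      map_add' := fun x y => by rw [hadd]; rfl }
  have hfo : IsOpenMap f := IsTopologicalAddGroup.isOpenMap_iff_nhds_zero.2 hopen
  have hfs : Function.Surjective f := by
    have ho : IsOpen (f.range : Set (Additive G)) := by
      rw [AddMonoidHom.coe_range]
      exact hfo.isOpen_range
    have : ConnectedSpace (Additive G) := ‹ConnectedSpace G›
    have hu : (f.range : Set (Additive G)) = Set.univ :=
      IsClopen.eq_univ ⟨AddSubgroup.isClosed_of_isOpen _ ho, ho⟩ ⟨0, f.range.zero_mem⟩
    intro y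
    have : y ∈ (f.range : Set (Additive G)) := hu ▸ Set.mem_univ y
    exact this
  have hq : Topology.IsQuotientMap f := hfo.isQuotientMap hc hfs
  have hdisc : IsDiscrete (f.ker : Set E) := by
    obtain ⟨l, hl⟩ := hinj
    obtain ⟨U, hU, hUo, h0U⟩ := eventually_nhds_iff.1 hl
    refine isDiscrete_iff_forall_mem_exists_isOpen.2 fun y hy => ⟨(fun x => x - y) ⁻¹' U,
      hUo.preimage (by fun_prop), ?_⟩
    have hker : ∀ x, x ∈ (f.ker : Set E) → e x = 1 := fun x hx => AddMonoidHom.mem_ker.1 hx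
    ext x
    refine ⟨fun ⟨hx1, hx2⟩ => ?_, ?_⟩
    · have h1 : e (x - y) = 1 := hker _ (f.ker.sub_mem hx2 hy)
      have h2 := hU _ hx1
      have h3 := hU 0 h0U
      rw [h1] at h2
      rw [he0] at h3
      exact sub_eq_zero.1 (h2.symm.trans h3)
    · rintro rfl
      exact ⟨by simpa using h0U, hy⟩
  exact (hq.isAddQuotientCoveringMap_of_isDiscrete_ker_addMonoidHom hdisc).isCoveringMap

lemma IsCoveringMap.bijective_of_simplyConnected {X Y : Type*} [TopologicalSpace X]
    [TopologicalSpace Y] [PreconnectedSpace X] [Nonempty X] [SimplyConnectedSpace Y]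
    [LocallyPathConnectedSpace Y] {p : X → Y} (hp : IsCoveringMap p) : Function.Bijective p := by
  obtain ⟨x₀⟩ := ‹Nonempty X›
  obtain ⟨s, ⟨hs0, hs⟩, -⟩ := hp.existsUnique_continuousMap_lifts (ContinuousMap.id Y) (p x₀) x₀ rfl
  have hps : ∀ y, p (s y) = y := congrFun hs
  have hsp : s ∘ p = id :=
    hp.eq_of_comp_eq (s.continuous.comp hp.continuous) continuous_id
      (funext fun x => hps (p x)) x₀ hs0
  have hsp' : ∀ x, s (p x) = x := congrFun hsp
  exact ⟨fun x y h => by rw [← hsp' x, h, hsp'], fun y => ⟨s y, hps y⟩⟩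

end Exponential

section VectorGroup

variable {E : Type*} [NormedAddCommGroup E] [NormedSpace ℝ E] [FiniteDimensional ℝ E]
  {G : Type*} [TopologicalSpace G] [ChartedSpace E G]

/-- A simply connected abelian Lie group is a vector group. -/
theorem exists_diffeomorph_of_simplyConnected [CommGroup G] [LieGroup 𝓘(ℝ, E) ∞ G]
    [SimplyConnectedSpace G] : ∃ Φ : Diffeomorph 𝓘(ℝ, E) 𝓘(ℝ, E) G E ∞,
      (∀ a b, Φ (a * b) = Φ a + Φ b) ∧ ∀ v, modelDeriv 𝓘(ℝ, E) 𝓘(ℝ, E) Φ 1 v = v := by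
  have := FiniteDimensional.complete ℝ E
  have := topologicalGroup_of_lieGroup 𝓘(ℝ, E) ∞ (G := G)
  have := ChartedSpace.locallyPathConnectedSpace E G
  obtain ⟨e, hes, hadd, hd⟩ := exists_exponential (E := E) (G := G)
  have he0 : e 0 = 1 := by
    have := hadd 0 0
    rwa [add_zero, left_eq_mul] at this
  obtain ⟨hopen, l, hls, hl⟩ := exists_localInverse hes.contMDiffAt hd
  rw [he0] at hopen hls
  have hb : Function.Bijective e := (isCoveringMap_of_exponential hes.continuous hadd hopen
    ⟨l, hl⟩).bijective_of_simplyConnected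
  let ψ : E ≃ G := Equiv.ofBijective e hb
  have hψ : ∀ x, ψ.symm (e x) = x := ψ.symm_apply_apply
  have hψ' : ∀ g, e (ψ.symm g) = g := ψ.apply_symm_apply
  have hmul : ∀ a b, ψ.symm (a * b) = ψ.symm a + ψ.symm b := fun a b => by
    apply hb.1
    rw [hadd, hψ', hψ', hψ']
  have hs1 : ContMDiffAt 𝓘(ℝ, E) 𝓘(ℝ, E) ∞ ψ.symm 1 := by
    refine hls.congr_of_eventuallyEq ?_
    refine Filter.Eventually.filter_mono hopen ?_
    rw [Filter.eventually_map]
    filter_upwards [hl] with y hy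
    rw [hψ, hy]
  have hs : ContMDiff 𝓘(ℝ, E) 𝓘(ℝ, E) ∞ ψ.symm := by
    intro g
    have h1 : ContMDiffAt 𝓘(ℝ, E) 𝓘(ℝ, E) ∞ (fun x : G => g⁻¹ * x) g :=
      contMDiff_mul_left.contMDiffAt
    have h2 := ContMDiffAt.comp g (g := ψ.symm) (f := fun x : G => g⁻¹ * x)
      (by rwa [inv_mul_cancel]) h1
    have h3 : ContMDiffAt 𝓘(ℝ, E) 𝓘(ℝ, E) ∞ (fun x => ψ.symm g + ψ.symm (g⁻¹ * x)) g :=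
      contMDiffAt_const.add h2
    refine h3.congr_of_eventuallyEq (Filter.Eventually.of_forall fun x => ?_)
    have h4 := hmul g (g⁻¹ * x)
    rwa [mul_inv_cancel_left] at h4
  refine ⟨⟨ψ.symm, hs, hes⟩, hmul, fun v => ?_⟩
  have h1 := modelDeriv_comp (I := 𝓘(ℝ, E)) (J := 𝓘(ℝ, E)) (K := 𝓘(ℝ, E)) (g := ψ.symm) (f := e)
    (x := 0) ((hs _).mdifferentiableAt (by simp)) ((hes 0).mdifferentiableAt (by simp)) v
  rw [hd, he0] at h1
  simp only [hψ, modelDeriv_id] at h1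
  exact h1.symm

end VectorGroup

end

noncomputable section

section Transport

variable {E : Type*} [NormedAddCommGroup E] [NormedSpace ℝ E]
  {G : Type*} [TopologicalSpace G] [ChartedSpace E G] [Group G] [LieGroup 𝓘(ℝ, E) ∞ G]
  {φ : G → E}

lemma modelDeriv_const_add (c x v : E) :
    modelDeriv 𝓘(ℝ, E) 𝓘(ℝ, E) (fun y : E => c + y) x v = v := by
  have h : HasFDerivAt (fun y : E => c + y) (ContinuousLinearMap.id ℝ E) x :=
    (hasFDerivAt_id x).const_add c
  exact congrArg (fun L : E →L[ℝ] E => L v) h.hasMFDerivAt.mfderiv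

lemma modelDeriv_derivMulLeft_of_hom (hs : ContMDiff 𝓘(ℝ, E) 𝓘(ℝ, E) ∞ φ)
    (hφ : ∀ a b, φ (a * b) = φ a + φ b) (a x : G) (v : E) :
    modelDeriv 𝓘(ℝ, E) 𝓘(ℝ, E) φ (a * x) (derivMulLeft 𝓘(ℝ, E) a x v) =
      modelDeriv 𝓘(ℝ, E) 𝓘(ℝ, E) φ x v := by
  have hd : MDifferentiable 𝓘(ℝ, E) 𝓘(ℝ, E) φ := hs.mdifferentiable (by simp)
  have h1 := modelDeriv_comp (g := φ) (hd (a * x)) (mdifferentiableAt_mulLeft a x) v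
  have hc : MDifferentiableAt 𝓘(ℝ, E) 𝓘(ℝ, E) (fun y : E => φ a + y) (φ x) :=
    mdifferentiableAt_const.add mdifferentiableAt_id
  have h2 := modelDeriv_comp (g := fun y => φ a + y) hc (hd x) v
  rw [modelDeriv_const_add] at h2
  simp only [← hφ] at h2
  exact h1.symm.trans h2

lemma modelDeriv_derivMulRight_of_hom (hs : ContMDiff 𝓘(ℝ, E) 𝓘(ℝ, E) ∞ φ)
    (hφ : ∀ a b, φ (a * b) = φ a + φ b) (a x : G) (v : E) :
    modelDeriv 𝓘(ℝ, E) 𝓘(ℝ, E) φ (x * a) (derivMulRight 𝓘(ℝ, E) a x v) =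
      modelDeriv 𝓘(ℝ, E) 𝓘(ℝ, E) φ x v := by
  have hd : MDifferentiable 𝓘(ℝ, E) 𝓘(ℝ, E) φ := hs.mdifferentiable (by simp)
  have h1 := modelDeriv_comp (g := φ) (f := fun y => y * a) (hd (x * a))
    (mdifferentiableAt_mulRight a x) v
  have hc : MDifferentiableAt 𝓘(ℝ, E) 𝓘(ℝ, E) (fun y : E => φ a + y) (φ x) :=
    mdifferentiableAt_const.add mdifferentiableAt_id
  have h2 := modelDeriv_comp (g := fun y => φ a + y) hc (hd x) v
  rw [modelDeriv_const_add] at h2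
  simp only [add_comm (φ a), ← hφ] at h2
  exact h1.symm.trans h2

lemma modelDeriv_eq_derivMulLeft_inv (hs : ContMDiff 𝓘(ℝ, E) 𝓘(ℝ, E) ∞ φ)
    (hφ : ∀ a b, φ (a * b) = φ a + φ b) (h1 : ∀ v, modelDeriv 𝓘(ℝ, E) 𝓘(ℝ, E) φ 1 v = v)
    (g : G) (v : E) :
    modelDeriv 𝓘(ℝ, E) 𝓘(ℝ, E) φ g v = derivMulLeft 𝓘(ℝ, E) g⁻¹ g v := by
  have h := modelDeriv_derivMulLeft_of_hom hs hφ g⁻¹ g v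
  rw [inv_mul_cancel, h1] at h
  exact h.symm

lemma MulPreservesConnection.isAffineMap_of_hom {cov : AffineConnection 𝓘(ℝ, E) G}
    (hm : MulPreservesConnection cov) (hs : ContMDiff 𝓘(ℝ, E) 𝓘(ℝ, E) ∞ φ)
    (hφ : ∀ a b, φ (a * b) = φ a + φ b) (h1 : ∀ v, modelDeriv 𝓘(ℝ, E) 𝓘(ℝ, E) φ 1 v = v) :
    IsAffineMap cov (canonicalConnection E) φ := by
  refine ⟨hs, fun x Y Y' hY hY' hrel v => ?_⟩
  have hd : MDifferentiable 𝓘(ℝ, E) 𝓘(ℝ, E) φ := hs.mdifferentiable (by simp)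
  have hdY : DifferentiableAt ℝ (fun z => (Y' z : E)) (φ x) :=
    differentiableAt_of_field hY'.mdifferentiableAt
  have h2 := congrArg (modelDeriv 𝓘(ℝ, E) 𝓘(ℝ, E) φ x) (hm.modelCov_eq hY v)
  have h3 := modelDeriv_derivMulLeft_of_hom hs hφ x 1
    (modelDeriv 𝓘(ℝ, E) 𝓘(ℝ, E) (fun g => derivMulLeft 𝓘(ℝ, E) g⁻¹ g (Y g)) x v)
  rw [mul_one, h1] at h3
  have h4 : (fun g => derivMulLeft 𝓘(ℝ, E) g⁻¹ g (Y g)) =ᶠ[𝓝 x] fun g => (Y' (φ g) : E) :=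
    hrel.mono fun g hg => (modelDeriv_eq_derivMulLeft_inv hs hφ h1 g (Y g)).symm.trans hg
  have h5 : modelDeriv 𝓘(ℝ, E) 𝓘(ℝ, E) (fun g => derivMulLeft 𝓘(ℝ, E) g⁻¹ g (Y g)) x v =
      modelDeriv 𝓘(ℝ, E) 𝓘(ℝ, E) (fun g => (Y' (φ g) : E)) x v :=
    congrArg (fun L : E →L[ℝ] E => L v) h4.mfderiv_eq
  have h6 := modelDeriv_comp (g := fun z => (Y' z : E)) hdY.mdifferentiableAt (hd x) v
  have h7 : modelDeriv 𝓘(ℝ, E) 𝓘(ℝ, E) (fun z => (Y' z : E)) (φ x) =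
      fderiv ℝ (fun z => (Y' z : E)) (φ x) := mfderiv_eq_fderiv
  rw [h7] at h6
  exact h2.trans (h3.trans (h5.trans h6))

end Transport

section PullbackOneForm

variable {E : Type*} [NormedAddCommGroup E] [NormedSpace ℝ E]
  {H : Type*} [TopologicalSpace H] {I : ModelWithCorners ℝ E H}
  {M : Type*} [TopologicalSpace M] [ChartedSpace H M] [IsManifold I ∞ M]

/-- The differential of a smooth function is a smooth 1-form. -/
lemma smooth_mvfderiv {f : M → ℝ} (hf : ContMDiff I 𝓘(ℝ, ℝ) ∞ f) :
    OneForm.Smooth (I := I) (fun x => mvfderiv I f x) := by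
  intro x
  refine (contMDiffAt_hom_bundle _).2 ⟨contMDiffAt_id, ?_⟩
  have h := (hf x).mfderiv_const (m := ∞) (by simp)
  refine h.congr_of_eventuallyEq (Filter.Eventually.of_forall fun y => ?_)
  simp only [inTangentCoordinates, ContinuousLinearMap.inCoordinates,
    TangentBundle.continuousLinearMapAt_model_space]
  exact congrArg (fun L : ℝ →L[ℝ] ℝ => L.comp ((mvfderiv I f y : E →L[ℝ] ℝ).comp
    ((trivializationAt E (TangentSpace I) x).symmL ℝ y : E →L[ℝ] E)))
    (Bundle.Trivial.continuousLinearMapAt_trivialization ℝ M ℝ y)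

end PullbackOneForm

section LinearBivector

variable {E : Type*} [NormedAddCommGroup E] [NormedSpace ℝ E]
  {G : Type*} [TopologicalSpace G] [ChartedSpace E G] [Group G] [LieGroup 𝓘(ℝ, E) ∞ G]

/-- The value of a bivector field, as a map on the model space. -/
def BivectorField.model {E : Type*} [NormedAddCommGroup E] [NormedSpace ℝ E]
    {H : Type*} [TopologicalSpace H] {I : ModelWithCorners ℝ E H}
    {M : Type*} [TopologicalSpace M] [ChartedSpace H M] (h : BivectorField I M) (x : M) :
    (E →L[ℝ] ℝ) →L[ℝ] E :=
  h x

/-- The coefficient function `h(φ^*α, φ^*β)`. -/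
def BivectorField.pullbackForm {E : Type*} [NormedAddCommGroup E] [NormedSpace ℝ E]
    {H : Type*} [TopologicalSpace H] {I : ModelWithCorners ℝ E H}
    {M : Type*} [TopologicalSpace M] [ChartedSpace H M] (h : BivectorField I M)
    (φ : M → E) (α β : E →L[ℝ] ℝ) (x : M) : ℝ :=
  β (modelDeriv I 𝓘(ℝ, E) φ x (h.model x (α.comp (modelDeriv I 𝓘(ℝ, E) φ x))))

lemma BivectorField.Smooth.continuous_pullbackForm
    {H : Type*} [TopologicalSpace H] {I : ModelWithCorners ℝ E H}
    {M : Type*} [TopologicalSpace M] [ChartedSpace H M] [IsManifold I ∞ M]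
    {h : BivectorField I M} (hh : h.Smooth)
    {φ : M → E} (hφ : ContMDiff I 𝓘(ℝ, E) ∞ φ) (α β : E →L[ℝ] ℝ) :
    Continuous (h.pullbackForm φ α β) := by
  have hα : ContMDiff I 𝓘(ℝ, ℝ) ∞ (fun x => α (φ x)) := α.contMDiff.comp hφ
  have h1 := smooth_mvfderiv hα
  have h2 : ContMDiff I I.tangent ∞
      (fun x => (⟨x, h x (mvfderiv I (fun x => α (φ x)) x)⟩ : TangentBundle I M)) :=
    ContMDiff.clm_bundle_apply (E₂ := (TangentSpace I : M → Type _)) hh h1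
  have h3 := (hφ.contMDiff_tangentMap (m := ∞) (by simp)).comp h2
  have h4 := (contMDiff_snd_tangentBundle_modelSpace E 𝓘(ℝ, E) (n := ∞)).comp h3
  have h5 := β.continuous.comp h4.continuous
  refine h5.congr fun x => ?_
  have e : (mvfderiv I (fun x => α (φ x)) x : E →L[ℝ] ℝ) =
      α.comp (modelDeriv I 𝓘(ℝ, E) φ x) := by
    ext v
    have h6 := modelDeriv_comp (g := α) (α.contMDiff (n := ∞) |>.mdifferentiableAt (by simp))
      ((hφ x).mdifferentiableAt (by simp)) v
    refine h6.trans ?_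
    exact congrArg (fun L : E →L[ℝ] ℝ => L (modelDeriv I 𝓘(ℝ, E) φ x v))
      α.hasFDerivAt.hasMFDerivAt.mfderiv
  exact congrArg (fun γ => β (modelDeriv I 𝓘(ℝ, E) φ x (h.model x γ))) e

lemma BivectorField.pullbackForm_mul {h : BivectorField 𝓘(ℝ, E) G} {φ : G → E}
    (hm : BivectorField.MapsTo (fun p : G × G => p.1 * p.2) (h.prod h) h)
    (hs : ContMDiff 𝓘(ℝ, E) 𝓘(ℝ, E) ∞ φ) (hφ : ∀ a b, φ (a * b) = φ a + φ b)
    (α β : E →L[ℝ] ℝ) (a b : G) :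
    h.pullbackForm φ α β (a * b) = h.pullbackForm φ α β a + h.pullbackForm φ α β b := by
  set D : G → E →L[ℝ] E := modelDeriv 𝓘(ℝ, E) 𝓘(ℝ, E) φ with hD
  set m : E × E →L[ℝ] E :=
    modelDeriv (𝓘(ℝ, E).prod 𝓘(ℝ, E)) 𝓘(ℝ, E) (fun p : G × G => p.1 * p.2) (a, b) with hmd
  have key : β (D (a * b) (m
      (h.model a ((α.comp ((D (a * b)).comp m)).comp (ContinuousLinearMap.inl ℝ E E)),
        h.model b ((α.comp ((D (a * b)).comp m)).comp (ContinuousLinearMap.inr ℝ E E))))) =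
      h.pullbackForm φ α β (a * b) :=
    hm (a, b) (α.comp (D (a * b))) (β.comp (D (a * b)))
  have hDm : ∀ u v, D (a * b) (m (u, v)) = D a u + D b v := fun u v => by
    rw [hmd, modelDeriv_mul, map_add, hD, modelDeriv_derivMulRight_of_hom hs hφ,
      modelDeriv_derivMulLeft_of_hom hs hφ]
  have e1 : (α.comp ((D (a * b)).comp m)).comp (ContinuousLinearMap.inl ℝ E E) =
      α.comp (D a) := by
    ext u
    have := hDm u 0
    simp only [map_zero, add_zero] at this
    simp [this]
  have e2 : (α.comp ((D (a * b)).comp m)).comp (ContinuousLinearMap.inr ℝ E E) =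
      α.comp (D b) := by
    ext u
    have := hDm 0 u
    simp only [map_zero, zero_add] at this
    simp [this]
  rw [e1, e2, hDm, map_add] at key
  exact key.symm

/-- The transport of a bivector field along an equivalence with a vector space. -/
def BivectorField.transport {M : Type*} [TopologicalSpace M] [ChartedSpace E M]
    (h : BivectorField 𝓘(ℝ, E) M) (φ : M → E) (ψ : E → M) : BivectorField 𝓘(ℝ, E) E := fun u =>
  let D : E →L[ℝ] E := modelDeriv 𝓘(ℝ, E) 𝓘(ℝ, E) φ (ψ u)
  (D.comp ((h.model (ψ u)).comp (ContinuousLinearMap.precomp ℝ D)) : (E →L[ℝ] ℝ) →L[ℝ] E)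

lemma BivectorField.mapsTo_transport {M : Type*} [TopologicalSpace M] [ChartedSpace E M]
    (h : BivectorField 𝓘(ℝ, E) M) {φ : M → E} {ψ : E → M} (hψ : ∀ x, ψ (φ x) = x) :
    BivectorField.MapsTo φ h (h.transport φ ψ) := by
  intro x α β
  have h1 : h.pullbackForm φ α β x = h.pullbackForm φ α β (ψ (φ x)) := by rw [hψ]
  exact h1

/-- The transport to a vector space of a multiplicative bivector field is linear. -/
lemma BivectorField.isLinearBivector_transport [FiniteDimensional ℝ E]
    {h : BivectorField 𝓘(ℝ, E) G}
    (hm : BivectorField.MapsTo (fun p : G × G => p.1 * p.2) (h.prod h) h)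
    (hh : h.Smooth) (hsymm : h.Symmetric)
    (Φ : Diffeomorph 𝓘(ℝ, E) 𝓘(ℝ, E) G E ∞) (hΦ : ∀ a b, Φ (a * b) = Φ a + Φ b) :
    IsLinearBivector (h.transport Φ Φ.symm) := by
  set h' := h.transport Φ Φ.symm
  have hadd : ∀ u w, Φ.symm (u + w) = Φ.symm u * Φ.symm w := fun u w => by
    refine Φ.injective (?_ : Φ _ = Φ _)
    rw [hΦ, Φ.apply_symm_apply, Φ.apply_symm_apply, Φ.apply_symm_apply]
  have hlin : ∀ α β : E →L[ℝ] ℝ, ∃ L : E →L[ℝ] ℝ, ∀ u, h'.form u α β = L u := fun α β => by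
    let A : E →+ ℝ := AddMonoidHom.mk' (fun u => h.pullbackForm Φ α β (Φ.symm u)) fun u w => by
      rw [hadd, BivectorField.pullbackForm_mul hm Φ.contMDiff hΦ]
    have hA : Continuous A :=
      (hh.continuous_pullbackForm Φ.contMDiff α β).comp Φ.symm.continuous
    exact ⟨A.toRealLinearMap hA, fun u => rfl⟩
  choose L hL using hlin
  have f1 : ∀ u (α₁ α₂ β : E →L[ℝ] ℝ),
      h'.form u (α₁ + α₂) β = h'.form u α₁ β + h'.form u α₂ β := fun u α₁ α₂ β =>
    (congrArg β (map_add (h'.model u) α₁ α₂)).trans (map_add β _ _)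
  have f2 : ∀ u (c : ℝ) (α β : E →L[ℝ] ℝ), h'.form u (c • α) β = c • h'.form u α β :=
    fun u c α β =>
      (congrArg β (map_smul (h'.model u) c α)).trans (map_smul β _ _)
  have f3 : ∀ u (α β₁ β₂ : E →L[ℝ] ℝ),
      h'.form u α (β₁ + β₂) = h'.form u α β₁ + h'.form u α β₂ := fun u α β₁ β₂ => rfl
  have f4 : ∀ u (c : ℝ) (α β : E →L[ℝ] ℝ), h'.form u α (c • β) = c • h'.form u α β :=
    fun u c α β => rfl
  refine ⟨LinearMap.mk₂ ℝ L ?_ ?_ ?_ ?_, fun α β => ?_, fun α β u => hL α β u⟩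
  · intro α₁ α₂ β
    ext u
    rw [add_apply, ← hL, ← hL, ← hL, f1]
  · intro c α β
    ext u
    rw [smul_apply, ← hL, ← hL, f2]
  · intro α β₁ β₂
    ext u
    rw [add_apply, ← hL, ← hL, ← hL, f3]
  · intro c α β
    ext u
    rw [smul_apply, ← hL, ← hL, f4]
  · ext u
    rw [LinearMap.mk₂_apply, LinearMap.mk₂_apply, ← hL, ← hL]
    have hs : ∀ γ δ : E →L[ℝ] ℝ, δ (h.model (Φ.symm u) γ) = γ (h.model (Φ.symm u) δ) :=
      fun γ δ => hsymm (Φ.symm u) γ δ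
    exact hs (α.comp (modelDeriv 𝓘(ℝ, E) 𝓘(ℝ, E) Φ (Φ.symm u)))
      (β.comp (modelDeriv 𝓘(ℝ, E) 𝓘(ℝ, E) Φ (Φ.symm u)))

end LinearBivector

end

theorem mainTheorem12 {E : Type*} [NormedAddCommGroup E] [NormedSpace ℝ E] [FiniteDimensional ℝ E]
    {G : Type*} [TopologicalSpace G] [ChartedSpace E G] [Group G] [LieGroup 𝓘(ℝ, E) ∞ G]
    (cov : AffineConnection 𝓘(ℝ, E) G) :
    (ConnectedSpace G → CovariantDerivative.ContMDiffCovariantDerivative cov ∞ →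
      MulPreservesConnection cov →
        (∀ a b : G, a * b = b * a) ∧ IsBiInvariant cov) ∧
    (SimplyConnectedSpace G → ∀ h : BivectorField 𝓘(ℝ, E) G,
      IsMultiplicativePseudoHessian cov h →
        ∃ (Φ : Diffeomorph 𝓘(ℝ, E) 𝓘(ℝ, E) G E ∞) (h' : BivectorField 𝓘(ℝ, E) E),
          (∀ a b : G, Φ (a * b) = Φ a + Φ b) ∧
          IsAffineMap cov (canonicalConnection E) Φ ∧
          BivectorField.MapsTo Φ h h' ∧
          IsLinearBivector h') := by
  refine ⟨fun _ _ hm => ⟨hm.mul_comm, hm.isBiInvariant⟩, fun _ h hh => ?_⟩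
  have hm := hh.mul_affine
  obtain ⟨Φ, hΦ, hd⟩ : ∃ Φ : Diffeomorph 𝓘(ℝ, E) 𝓘(ℝ, E) G E ∞,
      (∀ a b, Φ (a * b) = Φ a + Φ b) ∧ ∀ v, modelDeriv 𝓘(ℝ, E) 𝓘(ℝ, E) Φ 1 v = v := by
    let _ : CommGroup G := { ‹Group G› with mul_comm := hm.mul_comm }
    exact exists_diffeomorph_of_simplyConnected
  exact ⟨Φ, h.transport Φ Φ.symm, hΦ, hm.isAffineMap_of_hom Φ.contMDiff hΦ hd,
    h.mapsTo_transport Φ.symm_apply_apply,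
    BivectorField.isLinearBivector_transport hh.mul_mapsTo hh.pseudoHessian.smooth
      hh.pseudoHessian.symmetric Φ hΦ⟩
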